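/- Let $M$ be a smooth $7$-manifold and let $\varphi(t)$, $t\in J\subseteq\mathbb R$, be a family of $\mathrm{G}_2$-structures on $M$, that is, of smooth $3$-forms that are positive (at every point $x$, $\varphi(t)_x$ is the model form $e^{123}+e^{145}+e^{167}+e^{246}-e^{257}-e^{347}-e^{356}$ in some basis of $T_x^*M$). Each positive $\varphi$ determines a Riemannian metric $g$ and an orientation with volume form $\mathsf{vol}$ by $$(u\lrcorner\varphi)\wedge(v\lrcorner\varphi)\wedge\varphi=-6\,g(u,v)\,\mathsf{vol},$$ equivalently, in local coordinates, $g_{ij}=6^{-2/9}B_{ij}/\det(B)^{1/9}$ and $\mathsf{vol}=-6^{-7/9}\det(B)^{1/9}\,dx^1\wedge\cdots\wedge dx^7$, where $B_{ij}\,dx^1\wedge\cdots\wedge dx^7=(\partial_i\lrcorner\varphi)\wedge(\partial_j\lrcorner\varphi)\wedge\varphi$. Let $\psi=*\varphi$ be the dual $4$-form, $*$ being the Hodge star of $g$ and $\mathsf{vol}$ (so $\alpha\wedge *\beta=g(\alpha,\beta)\,\mathsf{vol}$). Let $h=h(t)$ be a (possibly time-dependent) symmetric $2$-tensor and $X=X(t)$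 a (possibly time-dependent) vector field on $M$, and suppose that $\varphi(t)$ satisfies the general flow equation for $t\in J$: in all local coordinates $$\frac{\partial}{\partial t}\varphi_{ijk}=h^l_i\varphi_{ljk}+h^l_j\varphi_{ilk}+h^l_k\varphi_{ijl}+X^l\psi_{lijk},$$ where repeated indices are summed from $1$ to $7$, indices are raised and lowered with $g=g(t)$, and $h^l_i=g^{lm}h_{mi}$. Then for all $t\in J$, and in all local coordinates, $\psi_{ijkl}$ is differentiable in $t$ and $$\frac{\partial}{\partial t}\psi_{ijkl}=h^m_i\psi_{mjkl}+h^m_j\psi_{imkl}+h^m_k\psi_{ijml}+h^m_l\psi_{ijkm}-X_i\varphi_{jkl}+X_j\varphi_{ikl}-X_k\varphi_{ijl}+X_l\varphi_{ijk},$$ where $X_k=g_{kl}X^l$. (Time derivatives are taken within $J$.) -/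

import Mathlib

open Set Module
open scoped Manifold ContDiff

noncomputable section

namespace G2Flow

/-! ### Exterior algebra on a seven-dimensional vector space -/

/-- The wedge product of a `k`-form and an `l`-form, as an `n`-form with `n = k + l`:
`(α ∧ β)(v₁, …, vₙ)` is the sum of `sgn σ α(v_σ(1), …, v_σ(k)) β(v_σ(k+1), …, v_σ(n))` over the
`(k, l)`-shuffles `σ`, so that `e¹ ∧ ⋯ ∧ eⁿ` is the determinant. -/
def wedge {V : Type*} [AddCommGroup V] [Module ℝ V] {k l n : ℕ} (h : k + l = n)
    (α : V [⋀^Fin k]→ₗ[ℝ] ℝ) (β : V [⋀^Fin l]→ₗ[ℝ] ℝ) : V [⋀^Fin n]→ₗ[ℝ] ℝ :=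
  ((LinearMap.mul' ℝ ℝ).compAlternatingMap (α.domCoprod β)).domDomCongr
    (finSumFinEquiv.trans (finCongr h))

/-- The decomposable three-form `eⁱ ∧ eʲ ∧ eᵏ` built from the basis dual to `b`. -/
def dualTriple {V : Type*} [AddCommGroup V] [Module ℝ V] (b : Basis (Fin 7) ℝ V)
    (i j k : Fin 7) : V [⋀^Fin 3]→ₗ[ℝ] ℝ :=
  (Matrix.detRowAlternating (R := ℝ) (n := Fin 3)).compLinearMap
    (LinearMap.pi ![b.coord i, b.coord j, b.coord k])

/-- The model `G₂` three-form
`e¹²³ + e¹⁴⁵ + e¹⁶⁷ + e²⁴⁶ - e²⁵⁷ - e³⁴⁷ - e³⁵⁶` in the basis `b` (indices here start at `0`). -/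
def modelForm {V : Type*} [AddCommGroup V] [Module ℝ V] (b : Basis (Fin 7) ℝ V) :
    V [⋀^Fin 3]→ₗ[ℝ] ℝ :=
  dualTriple b 0 1 2 + dualTriple b 0 3 4 + dualTriple b 0 5 6 + dualTriple b 1 3 5
    - dualTriple b 1 4 6 - dualTriple b 2 3 6 - dualTriple b 2 4 5

/-- A three-form is positive if it is the model form in some basis, that is, if it lies in the
`GL(7, ℝ)`-orbit of the model form. -/
def IsPositive {V : Type*} [AddCommGroup V] [Module ℝ V] (φ : V [⋀^Fin 3]→ₗ[ℝ] ℝ) : Prop :=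
  ∃ b : Basis (Fin 7) ℝ V, φ = modelForm b

/-- The top form `(u ⌟ φ) ∧ (v ⌟ φ) ∧ φ`. -/
def topForm {V : Type*} [AddCommGroup V] [Module ℝ V] (φ : V [⋀^Fin 3]→ₗ[ℝ] ℝ) (u v : V) :
    V [⋀^Fin 7]→ₗ[ℝ] ℝ :=
  wedge (show 4 + 3 = 7 from rfl)
    (wedge (show 2 + 2 = 4 from rfl) (φ.curryLeft u) (φ.curryLeft v)) φ

/-- The matrix `B_ij`, with
`B_ij dx¹ ∧ ⋯ ∧ dx⁷ = (∂_i ⌟ φ) ∧ (∂_j ⌟ φ) ∧ φ`, in the basis `b`. -/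
def matrixB {V : Type*} [AddCommGroup V] [Module ℝ V] (b : Basis (Fin 7) ℝ V)
    (φ : V [⋀^Fin 3]→ₗ[ℝ] ℝ) : Matrix (Fin 7) (Fin 7) ℝ :=
  fun i j => topForm φ (b i) (b j) b

/-- The real ninth root, an odd function. -/
def ninthRoot (x : ℝ) : ℝ := Real.sign x * |x| ^ (1 / 9 : ℝ)

/-- The metric of a positive three-form:
`g(u, v) = 6^(-2/9) * B(u, v) / det(B)^(1/9)`, where
`B(u, v)` is the value of `(u ⌟ φ) ∧ (v ⌟ φ) ∧ φ` on the basis `b`.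
It does not depend on `b`, see `metric_eq`. -/
def metric {V : Type*} [AddCommGroup V] [Module ℝ V] (b : Basis (Fin 7) ℝ V)
    (φ : V [⋀^Fin 3]→ₗ[ℝ] ℝ) (u v : V) : ℝ :=
  (6 : ℝ) ^ (-(2 / 9) : ℝ) * (topForm φ u v b / ninthRoot (matrixB b φ).det)

/-- The volume form of a positive three-form, for the orientation with
`(u ⌟ φ) ∧ (v ⌟ φ) ∧ φ = -6 g(u, v) vol`; its value on the basis `b` is
`-6^(-7/9) det(B)^(1/9)`, which is `√det(g)` if `b` is oriented and `-√det(g)` if not.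
It does not depend on `b`, see `volumeForm_eq`. -/
def volumeForm {V : Type*} [AddCommGroup V] [Module ℝ V] (b : Basis (Fin 7) ℝ V)
    (φ : V [⋀^Fin 3]→ₗ[ℝ] ℝ) : V [⋀^Fin 7]→ₗ[ℝ] ℝ :=
  (-((6 : ℝ) ^ (-(7 / 9) : ℝ) * ninthRoot (matrixB b φ).det)) • b.det

/-- The matrix `g_ij` of `g` in a frame. -/
def gram {V : Type*} (g : V → V → ℝ) (b : Fin 7 → V) : Matrix (Fin 7) (Fin 7) ℝ :=
  fun i j => g (b i) (b j)

/-- The vector `g^{ai} b_i`, metric dual to the `a`-th element of the dual basis. -/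
def raised {V : Type*} [AddCommGroup V] [Module ℝ V] (g : V → V → ℝ) (b : Fin 7 → V)
    (a : Fin 7) : V :=
  ∑ i, (gram g b)⁻¹ a i • b i

/-- The inner product of three-forms induced by `g`,
`g(α, β) = (1/3!) α_{abc} β_{ijk} g^{ai} g^{bj} g^{ck}`. -/
def innerThree {V : Type*} [AddCommGroup V] [Module ℝ V] (g : V → V → ℝ) (b : Fin 7 → V)
    (α β : V [⋀^Fin 3]→ₗ[ℝ] ℝ) : ℝ :=
  (1 / 6 : ℝ) * ∑ i, ∑ j, ∑ k,
    α ![raised g b i, raised g b j, raised g b k] * β ![b i, b j, b k]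

/-- The Hodge star on three-forms,
`(* β)_{jklm} = (1/3!) β_{abc} g^{ad} g^{be} g^{cf} vol_{defjklm}`.
It satisfies `α ∧ * β = g(α, β) vol` for all three-forms `α`, see `wedge_hodgeStar`. -/
def hodgeStar {V : Type*} [AddCommGroup V] [Module ℝ V] (g : V → V → ℝ)
    (vol : V [⋀^Fin 7]→ₗ[ℝ] ℝ) (b : Fin 7 → V) (β : V [⋀^Fin 3]→ₗ[ℝ] ℝ) :
    V [⋀^Fin 4]→ₗ[ℝ] ℝ :=
  (1 / 6 : ℝ) • ∑ i, ∑ j, ∑ k, β ![b i, b j, b k] •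
    ((vol.curryLeft (raised g b i)).curryLeft (raised g b j)).curryLeft (raised g b k)

/-- The dual four-form `ψ = * φ` of a positive three-form.
It does not depend on `b`, see `dualForm_eq`. -/
def dualForm {V : Type*} [AddCommGroup V] [Module ℝ V] (b : Basis (Fin 7) ℝ V)
    (φ : V [⋀^Fin 3]→ₗ[ℝ] ℝ) : V [⋀^Fin 4]→ₗ[ℝ] ℝ :=
  hodgeStar (metric b φ) (volumeForm b φ) b φ

theorem ninthRoot_pow_mul (x y : ℝ) : ninthRoot (x ^ 9 * y) = x * ninthRoot y := by
  have h : |x ^ 9| ^ (1 / 9 : ℝ) = |x| := by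
    rw [abs_pow, ← Real.rpow_natCast, ← Real.rpow_mul (abs_nonneg x)]
    norm_num
  unfold ninthRoot
  rw [abs_mul, Real.mul_rpow (abs_nonneg _) (abs_nonneg y), h]
  rcases lt_trichotomy x 0 with hx | hx | hx
  · have hp : x ^ 9 < 0 := Odd.pow_neg (by decide) hx
    rw [abs_of_neg hx]
    rcases lt_trichotomy y 0 with hy | hy | hy
    · rw [Real.sign_of_neg hy, Real.sign_of_pos (mul_pos_of_neg_of_neg hp hy)]; ring
    · simp [hy]
    · rw [Real.sign_of_pos hy, Real.sign_of_neg (mul_neg_of_neg_of_pos hp hy)]; ring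
  · simp [hx]
  · have hp : 0 < x ^ 9 := by positivity
    rw [abs_of_pos hx]
    rcases lt_trichotomy y 0 with hy | hy | hy
    · rw [Real.sign_of_neg hy, Real.sign_of_neg (mul_neg_of_pos_of_neg hp hy)]; ring
    · simp [hy]
    · rw [Real.sign_of_pos hy, Real.sign_of_pos (mul_pos hp hy)]; ring

/-- The wedge product as a bilinear map. -/
def wedgeHom (V : Type*) [AddCommGroup V] [Module ℝ V] {k l n : ℕ} (h : k + l = n) :
    (V [⋀^Fin k]→ₗ[ℝ] ℝ) →ₗ[ℝ] (V [⋀^Fin l]→ₗ[ℝ] ℝ) →ₗ[ℝ] (V [⋀^Fin n]→ₗ[ℝ] ℝ) :=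
  LinearMap.mk₂ ℝ (wedge h)
    (fun α α' β => by
      ext v
      simp [wedge, ← AlternatingMap.domCoprod'_apply, TensorProduct.add_tmul])
    (fun c α β => by
      ext v
      simp [wedge, ← AlternatingMap.domCoprod'_apply, ← TensorProduct.smul_tmul'])
    (fun α β β' => by
      ext v
      simp [wedge, ← AlternatingMap.domCoprod'_apply, TensorProduct.tmul_add])
    (fun c α β => by
      ext v
      simp [wedge, ← AlternatingMap.domCoprod'_apply])

theorem wedgeHom_apply {V : Type*} [AddCommGroup V] [Module ℝ V] {k l n : ℕ} (h : k + l = n)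
    (α : V [⋀^Fin k]→ₗ[ℝ] ℝ) (β : V [⋀^Fin l]→ₗ[ℝ] ℝ) :
    wedgeHom V h α β = wedge h α β := rfl

/-- Evaluation of alternating forms at a tuple, as a linear map. -/
def evalAt {V : Type*} [AddCommGroup V] [Module ℝ V] {n : ℕ} (v : Fin n → V) :
    (V [⋀^Fin n]→ₗ[ℝ] ℝ) →ₗ[ℝ] ℝ where
  toFun f := f v
  map_add' _ _ := rfl
  map_smul' _ _ := rfl

theorem evalAt_apply {V : Type*} [AddCommGroup V] [Module ℝ V] {n : ℕ} (v : Fin n → V)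
    (f : V [⋀^Fin n]→ₗ[ℝ] ℝ) : evalAt v f = f v := rfl

theorem topForm_apply_basis {V : Type*} [AddCommGroup V] [Module ℝ V]
    (b b' : Basis (Fin 7) ℝ V) (φ : V [⋀^Fin 3]→ₗ[ℝ] ℝ) (u v : V) :
    topForm φ u v b' = b.det b' * topForm φ u v b := by
  conv_lhs => rw [AlternatingMap.eq_smul_basis_det b (topForm φ u v)]
  simp [mul_comm]

theorem topForm_sum {V : Type*} [AddCommGroup V] [Module ℝ V]
    (b : Fin 7 → V) (φ : V [⋀^Fin 3]→ₗ[ℝ] ℝ) (x y : Fin 7 → ℝ) :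
    topForm φ (∑ i, x i • b i) (∑ j, y j • b j) =
      ∑ i, ∑ j, (x i * y j) • topForm φ (b i) (b j) := by
  simp only [topForm, ← wedgeHom_apply, map_sum, map_smul, LinearMap.sum_apply,
    LinearMap.smul_apply, Finset.smul_sum, smul_smul]
  rw [Finset.sum_comm]
  simp only [mul_comm]

theorem topForm_sum_apply {V : Type*} [AddCommGroup V] [Module ℝ V]
    (b w : Fin 7 → V) (φ : V [⋀^Fin 3]→ₗ[ℝ] ℝ) (x y : Fin 7 → ℝ) :
    topForm φ (∑ i, x i • b i) (∑ j, y j • b j) w =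
      ∑ i, ∑ j, x i * y j * topForm φ (b i) (b j) w := by
  rw [topForm_sum, ← evalAt_apply]
  simp only [map_sum, map_smul, evalAt_apply, smul_eq_mul]

theorem congruence_apply (F P : Matrix (Fin 7) (Fin 7) ℝ) (i j : Fin 7) :
    (P.transpose * F * P) i j = ∑ k, ∑ l, P k i * P l j * F k l := by
  rw [Finset.sum_comm]
  simp only [Matrix.mul_apply, Matrix.transpose_apply, Finset.sum_mul]
  refine Finset.sum_congr rfl fun _ _ => Finset.sum_congr rfl fun _ _ => by ring

theorem matrixB_apply {V : Type*} [AddCommGroup V] [Module ℝ V]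
    (b : Basis (Fin 7) ℝ V) (φ : V [⋀^Fin 3]→ₗ[ℝ] ℝ) (i j : Fin 7) :
    matrixB b φ i j = topForm φ (b i) (b j) b := rfl

theorem matrixB_eq_aux {V : Type*} [AddCommGroup V] [Module ℝ V]
    (b b' : Basis (Fin 7) ℝ V) (φ : V [⋀^Fin 3]→ₗ[ℝ] ℝ) (d : ℝ) (P : Matrix (Fin 7) (Fin 7) ℝ)
    (hd : ∀ u v, topForm φ u v b' = d * topForm φ u v b)
    (hP : ∀ i, b' i = ∑ k, P k i • b k) :
    matrixB b' φ = d • (P.transpose * matrixB b φ * P) := by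
  ext i j
  rw [matrixB_apply, Matrix.smul_apply, smul_eq_mul, hd, congruence_apply, hP i, hP j,
    topForm_sum_apply]
  simp only [matrixB_apply]

theorem matrixB_eq {V : Type*} [AddCommGroup V] [Module ℝ V]
    (b b' : Basis (Fin 7) ℝ V) (φ : V [⋀^Fin 3]→ₗ[ℝ] ℝ) :
    matrixB b' φ =
      b.det b' • ((b.toMatrix b').transpose * matrixB b φ * b.toMatrix b') :=
  matrixB_eq_aux b b' φ _ _ (topForm_apply_basis b b' φ)
    fun i => by simp [Basis.toMatrix_apply, b.sum_repr]

theorem ninthRoot_matrixB {V : Type*} [AddCommGroup V] [Module ℝ V]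
    (b b' : Basis (Fin 7) ℝ V) (φ : V [⋀^Fin 3]→ₗ[ℝ] ℝ) :
    ninthRoot (matrixB b' φ).det = b.det b' * ninthRoot (matrixB b φ).det := by
  rw [← ninthRoot_pow_mul, matrixB_eq b b', Matrix.det_smul, Matrix.det_mul, Matrix.det_mul,
    Matrix.det_transpose, Basis.det_apply, Fintype.card_fin]
  congr 1
  ring

/-- The metric does not depend on the basis used to write it down. -/
theorem metric_eq {V : Type*} [AddCommGroup V] [Module ℝ V]
    (b b' : Basis (Fin 7) ℝ V) (φ : V [⋀^Fin 3]→ₗ[ℝ] ℝ) : metric b' φ = metric b φ := by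
  funext u v
  have h : b.det b' ≠ 0 := (b.isUnit_det b').ne_zero
  rw [metric, metric, ninthRoot_matrixB b b', topForm_apply_basis b b',
    mul_div_mul_left _ _ h]

/-- The volume form does not depend on the basis used to write it down. -/
theorem volumeForm_eq {V : Type*} [AddCommGroup V] [Module ℝ V]
    (b b' : Basis (Fin 7) ℝ V) (φ : V [⋀^Fin 3]→ₗ[ℝ] ℝ) :
    volumeForm b' φ = volumeForm b φ := by
  have h : b.det = b.det b' • b'.det := AlternatingMap.eq_smul_basis_det b' b.det
  rw [volumeForm, volumeForm, ninthRoot_matrixB b b']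
  conv_rhs => rw [h]
  rw [smul_smul]
  congr 1
  ring

theorem wedge_eq_single {V : Type*} [AddCommGroup V] [Module ℝ V] {k l n : ℕ} (h : k + l = n)
    (α : V [⋀^Fin k]→ₗ[ℝ] ℝ) (β : V [⋀^Fin l]→ₗ[ℝ] ℝ) (v : Fin n → V)
    (hβ : ∀ σ : Equiv.Perm (Fin k ⊕ Fin l), ∀ x y, σ (Sum.inr x) = Sum.inl y →
      β (fun i => v (finCongr h (finSumFinEquiv (σ (Sum.inr i))))) = 0) :
    wedge h α β v = α (fun i => v (finCongr h (finSumFinEquiv (Sum.inl i)))) *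
      β (fun i => v (finCongr h (finSumFinEquiv (Sum.inr i)))) := by
  simp only [wedge, AlternatingMap.domDomCongr_apply, LinearMap.compAlternatingMap_apply,
    AlternatingMap.domCoprod_apply]
  rw [_root_.sum_apply, map_sum]
  refine (Finset.sum_eq_single
    (Quotient.mk'' 1 : Equiv.Perm.ModSumCongr (Fin k) (Fin l)) ?_ ?_).trans ?_
  rotate_left 2
  · rw [AlternatingMap.domCoprod.summand_mk'']
    simp
  · intro σ _ hσ
    induction σ using Quotient.inductionOn' with
    | h σ =>
    rw [AlternatingMap.domCoprod.summand_mk'']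
    have hr : ¬ ∀ x : Fin l, ∃ y : Fin l, σ (Sum.inr x) = Sum.inr y := by
      intro hx
      apply hσ
      rw [eq_comm]
      apply Quotient.sound'
      rw [QuotientGroup.leftRel_apply]
      simp only [inv_one, one_mul]
      apply Equiv.Perm.mem_sumCongrHom_range_of_perm_mapsTo_inl
      rw [Equiv.Perm.perm_mapsTo_inl_iff_mapsTo_inr]
      rintro _ ⟨x, rfl⟩
      obtain ⟨y, hy⟩ := hx x
      exact ⟨y, hy.symm⟩
    push Not at hr
    obtain ⟨x, hx⟩ := hr
    obtain ⟨y, hy⟩ : ∃ y : Fin k, σ (Sum.inr x) = Sum.inl y := by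
      cases h : σ (Sum.inr x) with
      | inl y => exact ⟨y, rfl⟩
      | inr y => exact absurd h (hx y)
    rw [_root_.smul_apply, LinearMap.map_smul_of_tower]
    simp only [MultilinearMap.domDomCongr_apply, MultilinearMap.domCoprod_apply,
      LinearMap.mul'_apply, Function.comp_apply, Equiv.trans_apply,
      AlternatingMap.coe_multilinearMap]
    rw [hβ σ x y hy, mul_zero, smul_zero]
  · simp

theorem wedge_contract_basis_aux {V : Type*} [AddCommGroup V] [Module ℝ V]
    (b : Fin 7 → V) (vol : V [⋀^Fin 7]→ₗ[ℝ] ℝ) (α : V [⋀^Fin 3]→ₗ[ℝ] ℝ) :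
    wedge (show 3 + 4 = 7 from rfl) α
      (((vol.curryLeft (b 0)).curryLeft (b 1)).curryLeft (b 2)) b =
        α ![b 0, b 1, b 2] * vol b := by
  have h1 : (fun i : Fin 3 => b (finCongr (show 3 + 4 = 7 from rfl)
      (finSumFinEquiv (Sum.inl i)))) = ![b 0, b 1, b 2] := by
    funext i; fin_cases i <;> rfl
  have h2 : Matrix.vecCons (b 0) (Matrix.vecCons (b 1) (Matrix.vecCons (b 2)
      (fun i : Fin 4 => b (finCongr (show 3 + 4 = 7 from rfl)
        (finSumFinEquiv (Sum.inr i)))))) = b := by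
    funext i; fin_cases i <;> rfl
  rw [wedge_eq_single, h1, AlternatingMap.curryLeft_apply_apply,
    AlternatingMap.curryLeft_apply_apply, AlternatingMap.curryLeft_apply_apply, h2]
  intro σ x y hy
  simp only [AlternatingMap.curryLeft_apply_apply]
  refine vol.map_eq_zero_of_eq _ (i := Fin.castAdd 4 y) (j := Fin.natAdd 3 x) ?_ ?_
  · have h3 : b (finCongr (show 3 + 4 = 7 from rfl) (finSumFinEquiv (σ (Sum.inr x)))) =
        b (Fin.castAdd 4 y) := by
      rw [hy]; rfl
    have h4 : Matrix.vecCons (b 0) (Matrix.vecCons (b 1) (Matrix.vecCons (b 2)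
      (fun i : Fin 4 => b (finCongr (show 3 + 4 = 7 from rfl)
        (finSumFinEquiv (σ (Sum.inr i))))))) (Fin.natAdd 3 x) =
        b (finCongr (show 3 + 4 = 7 from rfl) (finSumFinEquiv (σ (Sum.inr x)))) := by
      fin_cases x <;> rfl
    refine Eq.trans ?_ (h4.trans h3).symm
    fin_cases y <;> rfl
  · intro h
    have := congrArg Fin.val h
    simp at this
    omega

theorem eq_smul_of_basis {V : Type*} [AddCommGroup V] [Module ℝ V]
    (b : Basis (Fin 7) ℝ V) (f f' : V [⋀^Fin 7]→ₗ[ℝ] ℝ) (c : ℝ) (h : f b = c * f' b) :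
    f = c • f' := by
  have h1 := AlternatingMap.eq_smul_basis_det b f
  have h2 := AlternatingMap.eq_smul_basis_det b f'
  generalize b.det = D at *
  rw [h1, h, mul_smul, ← h2]

theorem wedge_contract_basis {V : Type*} [AddCommGroup V] [Module ℝ V]
    (b : Basis (Fin 7) ℝ V) (vol : V [⋀^Fin 7]→ₗ[ℝ] ℝ) (α : V [⋀^Fin 3]→ₗ[ℝ] ℝ) :
    wedge (show 3 + 4 = 7 from rfl) α
      (((vol.curryLeft (b 0)).curryLeft (b 1)).curryLeft (b 2)) =
      α ![b 0, b 1, b 2] • vol :=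
  eq_smul_of_basis b _ _ _ (wedge_contract_basis_aux b vol α)

theorem wedge_contract {V : Type*} [AddCommGroup V] [Module ℝ V]
    (b : Basis (Fin 7) ℝ V) (vol : V [⋀^Fin 7]→ₗ[ℝ] ℝ) (α : V [⋀^Fin 3]→ₗ[ℝ] ℝ) (u v w : V) :
    wedge (show 3 + 4 = 7 from rfl) α (((vol.curryLeft u).curryLeft v).curryLeft w) = α ![u, v, w] • vol := by
  have hα : ∀ u v w, α ![u, v, w] =
    evalAt ![] (((α.curryLeft u).curryLeft v).curryLeft w) := fun _ _ _ => rfl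
  have hz : ∀ i j k : Fin 7,
      wedge (show 3 + 4 = 7 from rfl) α (((vol.curryLeft (b i)).curryLeft (b j)).curryLeft (b k)) =
        α ![b i, b j, b k] • vol := by
    intro i j k
    by_cases hinj : Function.Injective ![i, j, k]
    · obtain ⟨τ, hτ⟩ : ∃ τ : Equiv.Perm (Fin 7), ∀ a : Fin 3,
          τ (Fin.castAdd 4 a) = ![i, j, k] a :=
        Equiv.Perm.exists_extending_pair _ _ (Fin.castAdd_injective 3 4) hinj
      have := wedge_contract_basis (b.reindex τ.symm) vol α
      have h0 := hτ 0
      have h1 := hτ 1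
      have h2 := hτ 2
      simp at h0 h1 h2
      simpa [h0, h1, h2] using this
    · have h3 : ∀ n (f : V [⋀^Fin (n + 3)]→ₗ[ℝ] ℝ),
          (((f.curryLeft (b i)).curryLeft (b j)).curryLeft (b k)) = 0 := by
        intro n f
        have : i = j ∨ i = k ∨ j = k := by
          by_contra! h
          apply hinj
          intro x y
          fin_cases x <;> fin_cases y <;> simp [h.1, h.2.1, h.2.2, h.1.symm, h.2.1.symm, h.2.2.symm]
        ext x
        simp only [AlternatingMap.curryLeft_apply_apply, AlternatingMap.zero_apply]
        rcases this with h | h | h <;> replace h := congrArg b h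
        · exact f.map_eq_zero_of_eq _ (i := ⟨0, by omega⟩) (j := ⟨1, by omega⟩) (by exact h) (by simp)
        · exact f.map_eq_zero_of_eq _ (i := ⟨0, by omega⟩) (j := ⟨2, by omega⟩) (by exact h) (by simp)
        · exact f.map_eq_zero_of_eq _ (i := ⟨1, by omega⟩) (j := ⟨2, by omega⟩) (by exact h) (by simp)
      rw [hα, h3 4, h3 0, ← wedgeHom_apply]
      simp
  rw [hα, ← b.sum_repr u, ← b.sum_repr v, ← b.sum_repr w]
  simp only [hα] at hz
  simp only [← wedgeHom_apply, ← AlternatingMap.curryLeftLinearMap_apply] at hz ⊢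
  simp only [map_sum, map_smul, LinearMap.sum_apply, LinearMap.smul_apply, hz,
    Finset.sum_smul, smul_assoc]

/-- The defining property of the Hodge star. -/
theorem wedge_hodgeStar {V : Type*} [AddCommGroup V] [Module ℝ V]
    (b : Basis (Fin 7) ℝ V) (g : V → V → ℝ) (vol : V [⋀^Fin 7]→ₗ[ℝ] ℝ)
    (α β : V [⋀^Fin 3]→ₗ[ℝ] ℝ) :
    wedge (show 3 + 4 = 7 from rfl) α (hodgeStar g vol b β) = innerThree g b α β • vol := by
  simp only [hodgeStar, ← wedgeHom_apply, map_sum, map_smul]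
  simp only [wedgeHom_apply, wedge_contract b, innerThree, smul_smul, ← Finset.sum_smul]
  simp only [mul_comm]

theorem metric_gram_eq {V : Type*} [AddCommGroup V] [Module ℝ V]
    (b b' : Basis (Fin 7) ℝ V) (φ : V [⋀^Fin 3]→ₗ[ℝ] ℝ) (P : Matrix (Fin 7) (Fin 7) ℝ)
    (hP : ∀ i, b' i = ∑ k, P k i • b k) :
    gram (metric b φ) b' = P.transpose * gram (metric b φ) b * P := by
  ext i j
  rw [congruence_apply, gram, hP i, hP j]
  simp only [metric, topForm_sum_apply, gram, Finset.sum_div, Finset.mul_sum]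
  refine Finset.sum_congr rfl fun _ _ => Finset.sum_congr rfl fun _ _ => by ring

theorem contract_eq {V N : Type*} [AddCommGroup V] [Module ℝ V] [AddCommGroup N] [Module ℝ N]
    (g : V → V → ℝ) (b b' : Fin 7 → V) (P Q : Matrix (Fin 7) (Fin 7) ℝ) (hPQ : P * Q = 1)
    (hP : ∀ i, b' i = ∑ k, P k i • b k)
    (hg : gram g b' = P.transpose * gram g b * P) (F : V →ₗ[ℝ] V →ₗ[ℝ] N) :
    ∑ a, F (b' a) (raised g b' a) = ∑ a, F (b a) (raised g b a) := by
  have hQ : P⁻¹ = Q := Matrix.inv_eq_right_inv hPQ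
  have hr : ∀ a, raised g b' a = ∑ c, Q a c • raised g b c := by
    intro a
    have h1 : (gram g b')⁻¹ * P.transpose = Q * (gram g b)⁻¹ := by
      rw [hg, Matrix.mul_inv_rev, Matrix.mul_inv_rev, hQ, Matrix.mul_assoc, Matrix.mul_assoc,
        ← Matrix.transpose_nonsing_inv, hQ, ← Matrix.transpose_mul, hPQ, Matrix.transpose_one,
        Matrix.mul_one]
    have h2 : ∀ k, ∑ i, (gram g b')⁻¹ a i * P k i = ∑ c, Q a c * (gram g b)⁻¹ c k := fun k => by
      have := congrFun (congrFun h1 a) k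
      simpa only [Matrix.mul_apply, Matrix.transpose_apply] using this
    simp only [raised, hP, Finset.smul_sum, smul_smul]
    rw [Finset.sum_comm]
    conv_rhs => rw [Finset.sum_comm]
    simp only [← Finset.sum_smul, h2]
  simp only [hr, hP, map_sum, map_smul, LinearMap.sum_apply, LinearMap.smul_apply,
    Finset.smul_sum, smul_smul]
  rw [Finset.sum_comm]
  have h3 : ∀ c k, ∑ a, Q a c * P k a = (1 : Matrix (Fin 7) (Fin 7) ℝ) k c := fun c k => by
    rw [← hPQ, Matrix.mul_apply]
    exact Finset.sum_congr rfl fun _ _ => mul_comm _ _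
  refine Finset.sum_congr rfl fun c _ => ?_
  rw [Finset.sum_comm]
  simp only [← Finset.sum_smul, h3, Matrix.one_apply, ite_smul, one_smul, zero_smul,
    Finset.sum_ite_eq', Finset.mem_univ, if_true]

/-- The dual four-form does not depend on the basis used to write it down. -/
theorem dualForm_eq {V : Type*} [AddCommGroup V] [Module ℝ V]
    (b b' : Basis (Fin 7) ℝ V) (φ : V [⋀^Fin 3]→ₗ[ℝ] ℝ) : dualForm b' φ = dualForm b φ := by
  have hP : ∀ i, b' i = ∑ k, b.toMatrix b' k i • b k := fun i => by
    simp [Basis.toMatrix_apply, b.sum_repr]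
  have hc : ∀ F : V → V → (V [⋀^Fin 4]→ₗ[ℝ] ℝ),
      (∀ x y z, F (x + y) z = F x z + F y z) → (∀ (c : ℝ) x z, F (c • x) z = c • F x z) →
      (∀ x y z, F x (y + z) = F x y + F x z) → (∀ (c : ℝ) x z, F x (c • z) = c • F x z) →
      ∑ a, F (b' a) (raised (metric b φ) b' a) = ∑ a, F (b a) (raised (metric b φ) b a) :=
    fun F h1 h2 h3 h4 =>
      contract_eq (metric b φ) b b' (b.toMatrix b') (b'.toMatrix b)
        (b.toMatrix_mul_toMatrix_flip b') hP (metric_gram_eq b b' φ _ hP)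
        (LinearMap.mk₂ ℝ F h1 h2 h3 h4)
  rw [dualForm, dualForm, metric_eq b b', volumeForm_eq b b']
  generalize metric b φ = g at *
  generalize volumeForm b φ = vol at *
  have hφ : ∀ u v w, φ ![u, v, w] =
    evalAt ![] (((φ.curryLeft u).curryLeft v).curryLeft w) := fun _ _ _ => rfl
  simp only [hodgeStar, hφ, ← AlternatingMap.curryLeftLinearMap_apply]
  congr 1
  have s1 := hc (fun u u' => ∑ j, ∑ k,
    evalAt ![] (AlternatingMap.curryLeftLinearMap (AlternatingMap.curryLeftLinearMap
      (AlternatingMap.curryLeftLinearMap φ u) (b j)) (b k)) •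
    AlternatingMap.curryLeftLinearMap (AlternatingMap.curryLeftLinearMap
      (AlternatingMap.curryLeftLinearMap vol u') (raised g b j)) (raised g b k))
    (by simp [add_smul, Finset.sum_add_distrib])
    (by simp [mul_smul, Finset.smul_sum])
    (by simp [Finset.sum_add_distrib])
    (by simp [Finset.smul_sum, smul_smul, mul_comm])
  rw [← s1]
  refine Finset.sum_congr rfl fun i _ => ?_
  have s2 := hc (fun v v' => ∑ k,
    evalAt ![] (AlternatingMap.curryLeftLinearMap (AlternatingMap.curryLeftLinearMap
      (AlternatingMap.curryLeftLinearMap φ (b' i)) v) (b k)) •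
    AlternatingMap.curryLeftLinearMap (AlternatingMap.curryLeftLinearMap
      (AlternatingMap.curryLeftLinearMap vol (raised g b' i)) v') (raised g b k))
    (by simp [add_smul, Finset.sum_add_distrib])
    (by simp [mul_smul, Finset.smul_sum])
    (by simp [Finset.sum_add_distrib])
    (by simp [Finset.smul_sum, smul_smul, mul_comm])
  rw [← s2]
  refine Finset.sum_congr rfl fun j _ => ?_
  exact hc (fun w w' =>
    evalAt ![] (AlternatingMap.curryLeftLinearMap (AlternatingMap.curryLeftLinearMap
      (AlternatingMap.curryLeftLinearMap φ (b' i)) (b' j)) w) •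
    AlternatingMap.curryLeftLinearMap (AlternatingMap.curryLeftLinearMap
      (AlternatingMap.curryLeftLinearMap vol (raised g b' i)) (raised g b' j)) w')
    (by simp [add_smul])
    (by simp [mul_smul])
    (by simp)
    (by simp [smul_smul, mul_comm])

/-! ### `G₂`-structures on a seven-manifold and their flows -/

/-- The coordinate basis of `T_x M` for the preferred chart at `x`. -/
def tangentBasis {M : Type*} [TopologicalSpace M] [ChartedSpace (EuclideanSpace ℝ (Fin 7)) M]
    (x : M) : Basis (Fin 7) ℝ (TangentSpace (𝓡 7) x) :=
  (EuclideanSpace.basisFun (Fin 7) ℝ).toBasis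

/-- The coordinate vector field `∂/∂xⁱ` of the chart `e`, at the point with coordinates `y`. -/
def coordFrame {M : Type*} [TopologicalSpace M] [ChartedSpace (EuclideanSpace ℝ (Fin 7)) M]
    (e : OpenPartialHomeomorph M (EuclideanSpace ℝ (Fin 7))) (y : EuclideanSpace ℝ (Fin 7))
    (i : Fin 7) : TangentSpace (𝓡 7) (e.symm y) :=
  mfderiv (𝓡 7) (𝓡 7) e.symm y (EuclideanSpace.single i (1 : ℝ) : EuclideanSpace ℝ (Fin 7))

/-- The coordinate `v^l = dx^l(v)` of a tangent vector in the chart `e`, at the point with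
coordinates `y`. -/
def coordComponent {M : Type*} [TopologicalSpace M]
    [ChartedSpace (EuclideanSpace ℝ (Fin 7)) M]
    (e : OpenPartialHomeomorph M (EuclideanSpace ℝ (Fin 7))) (y : EuclideanSpace ℝ (Fin 7))
    (v : TangentSpace (𝓡 7) (e.symm y)) (l : Fin 7) : ℝ :=
  (show EuclideanSpace ℝ (Fin 7) from mfderiv (𝓡 7) (𝓡 7) e (e.symm y) v) l

/-- A `G₂`-structure on a seven-manifold: a smooth positive three-form. -/
structure G2Structure (M : Type*) [TopologicalSpace M]
    [ChartedSpace (EuclideanSpace ℝ (Fin 7)) M] where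
  /-- The three-form. -/
  form : ∀ x : M, TangentSpace (𝓡 7) x [⋀^Fin 3]→ₗ[ℝ] ℝ
  /-- The components of the form in every chart of the smooth structure are smooth. -/
  smooth : ∀ e ∈ IsManifold.maximalAtlas (𝓡 7) ∞ M, ∀ i j k : Fin 7,
    ContDiffOn ℝ ∞ (fun y => form (e.symm y)
      ![coordFrame e y i, coordFrame e y j, coordFrame e y k]) e.target
  /-- The form is positive at every point. -/
  positive : ∀ x, IsPositive (form x)

/-- The Riemannian metric of a `G₂`-structure. -/
def G2Structure.metric {M : Type*} [TopologicalSpace M]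
    [ChartedSpace (EuclideanSpace ℝ (Fin 7)) M] (φ : G2Structure M) (x : M)
    (u v : TangentSpace (𝓡 7) x) : ℝ :=
  G2Flow.metric (tangentBasis x) (φ.form x) u v

/-- The dual four-form `ψ = * φ` of a `G₂`-structure. -/
def G2Structure.psi {M : Type*} [TopologicalSpace M]
    [ChartedSpace (EuclideanSpace ℝ (Fin 7)) M] (φ : G2Structure M) (x : M) :
    TangentSpace (𝓡 7) x [⋀^Fin 4]→ₗ[ℝ] ℝ :=
  dualForm (tangentBasis x) (φ.form x)

/-- The component `φ_ijk` in the chart `e`, at the point with coordinates `y`. -/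
def G2Structure.phiComp {M : Type*} [TopologicalSpace M]
    [ChartedSpace (EuclideanSpace ℝ (Fin 7)) M] (φ : G2Structure M)
    (e : OpenPartialHomeomorph M (EuclideanSpace ℝ (Fin 7))) (y : EuclideanSpace ℝ (Fin 7))
    (i j k : Fin 7) : ℝ :=
  φ.form (e.symm y) ![coordFrame e y i, coordFrame e y j, coordFrame e y k]

/-- The component `ψ_ijkl` in the chart `e`, at the point with coordinates `y`. -/
def G2Structure.psiComp {M : Type*} [TopologicalSpace M]
    [ChartedSpace (EuclideanSpace ℝ (Fin 7)) M] (φ : G2Structure M)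
    (e : OpenPartialHomeomorph M (EuclideanSpace ℝ (Fin 7))) (y : EuclideanSpace ℝ (Fin 7))
    (i j k l : Fin 7) : ℝ :=
  φ.psi (e.symm y)
    ![coordFrame e y i, coordFrame e y j, coordFrame e y k, coordFrame e y l]

/-- The matrix `g_ij` in the chart `e`, at the point with coordinates `y`. -/
def G2Structure.metricComp {M : Type*} [TopologicalSpace M]
    [ChartedSpace (EuclideanSpace ℝ (Fin 7)) M] (φ : G2Structure M)
    (e : OpenPartialHomeomorph M (EuclideanSpace ℝ (Fin 7))) (y : EuclideanSpace ℝ (Fin 7)) :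
    Matrix (Fin 7) (Fin 7) ℝ :=
  gram (φ.metric (e.symm y)) (coordFrame e y)

/-- The mixed component `h^l_i = g^{lm} h_{mi}` of a bilinear form `h` in the chart `e`, at the
point with coordinates `y`. -/
def G2Structure.mixedComp {M : Type*} [TopologicalSpace M]
    [ChartedSpace (EuclideanSpace ℝ (Fin 7)) M] (φ : G2Structure M)
    (e : OpenPartialHomeomorph M (EuclideanSpace ℝ (Fin 7))) (y : EuclideanSpace ℝ (Fin 7))
    (h : LinearMap.BilinForm ℝ (TangentSpace (𝓡 7) (e.symm y))) (l i : Fin 7) : ℝ :=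
  ∑ m, (φ.metricComp e y)⁻¹ l m * h (coordFrame e y m) (coordFrame e y i)

/-- The lowered component `X_k = g_{kl} X^l` of a tangent vector `X` in the chart `e`, at the
point with coordinates `y`. -/
def G2Structure.lowerComp {M : Type*} [TopologicalSpace M]
    [ChartedSpace (EuclideanSpace ℝ (Fin 7)) M] (φ : G2Structure M)
    (e : OpenPartialHomeomorph M (EuclideanSpace ℝ (Fin 7))) (y : EuclideanSpace ℝ (Fin 7))
    (X : TangentSpace (𝓡 7) (e.symm y)) (k : Fin 7) : ℝ :=
  ∑ l, φ.metricComp e y k l * coordComponent e y X l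

/-- The general flow equation, in every chart of the smooth structure and for all times `t ∈ J`:
`∂ₜ φ_ijk = h^l_i φ_ljk + h^l_j φ_ilk + h^l_k φ_ijl + X^l ψ_lijk`. -/
def IsGeneralFlow {M : Type*} [TopologicalSpace M]
    [ChartedSpace (EuclideanSpace ℝ (Fin 7)) M] (J : Set ℝ) (φ : ℝ → G2Structure M)
    (h : ℝ → ∀ x : M, LinearMap.BilinForm ℝ (TangentSpace (𝓡 7) x))
    (X : ℝ → ∀ x : M, TangentSpace (𝓡 7) x) : Prop :=
  ∀ t ∈ J, ∀ e ∈ IsManifold.maximalAtlas (𝓡 7) ∞ M, ∀ y ∈ e.target, ∀ i j k : Fin 7,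
    HasDerivWithinAt (fun s => (φ s).phiComp e y i j k)
      (∑ l, ((φ t).mixedComp e y (h t (e.symm y)) l i * (φ t).phiComp e y l j k
        + (φ t).mixedComp e y (h t (e.symm y)) l j * (φ t).phiComp e y i l k
        + (φ t).mixedComp e y (h t (e.symm y)) l k * (φ t).phiComp e y i j l
        + coordComponent e y (X t (e.symm y)) l * (φ t).psiComp e y l i j k)) J t

end G2Flow

end

/-!
Write `A · f` for the derivation of alternating forms induced by an endomorphism `A`. At a point,
the flow equation reads `φ' = h♯ · φ + X ⌟ ψ`. If `C` is `-1/3` times the cross product with `X`,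
then `C · φ = X ⌟ ψ` and `C · ψ = -X♭ ∧ φ`; both are linear in `X` and reduce, in a basis adapted to
`φ`, to finitely many identities between the coefficients of the model forms. Hence `φ' = A · φ`
with `A = h♯ + C`.

The map `φ ↦ ψ` is equivariant under linear automorphisms and differentiable at positive forms.
Therefore `φ` may be replaced by the curve `s ↦ (1 + s A)^* φ`, which has the same velocity, and
along which the dual form is `(1 + s A)^* ψ`. Thus `ψ' = A · ψ = h♯ · ψ - X♭ ∧ φ`.
-/

noncomputable section

namespace G2Flow


section Wedge

variable {V : Type*} [AddCommGroup V] [Module ℝ V] {k l n : ℕ}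

theorem wedge_apply (h : k + l = n) (α : V [⋀^Fin k]→ₗ[ℝ] ℝ) (β : V [⋀^Fin l]→ₗ[ℝ] ℝ)
    (v : Fin n → V) :
    wedge h α β v = (k.factorial * l.factorial : ℝ)⁻¹ * ∑ σ : Equiv.Perm (Fin n),
      Equiv.Perm.sign σ • (α (fun i => v (σ (Fin.cast h (Fin.castAdd l i))))
        * β (fun i => v (σ (Fin.cast h (Fin.natAdd k i))))) := by
  subst h
  rw [eq_inv_mul_iff_mul_eq₀ (by positivity)]
  have key := congrArg (fun F => LinearMap.mul' ℝ ℝ (F (v ∘ finSumFinEquiv)))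
    (MultilinearMap.domCoprod_alternization_eq α β)
  rw [MultilinearMap.alternatization_apply, map_sum,
    ← Equiv.sum_comp finSumFinEquiv.symm.permCongr] at key
  simp only [Fintype.card_fin, AlternatingMap.smul_apply, LinearMap.map_smul_of_tower,
    Equiv.Perm.sign_permCongr, MultilinearMap.domDomCongr_apply] at key
  rw [← Nat.cast_mul, ← nsmul_eq_mul]
  refine key.symm.trans (Finset.sum_congr rfl fun σ _ => ?_)
  simp [MultilinearMap.domCoprod_apply, Equiv.permCongr_apply]

theorem wedge_compLinearMap {W : Type*} [AddCommGroup W] [Module ℝ W] (h : k + l = n)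
    (α : V [⋀^Fin k]→ₗ[ℝ] ℝ) (β : V [⋀^Fin l]→ₗ[ℝ] ℝ) (f : W →ₗ[ℝ] V) :
    wedge h (α.compLinearMap f) (β.compLinearMap f) = (wedge h α β).compLinearMap f := by
  ext v
  simp only [AlternatingMap.compLinearMap_apply, wedge_apply]

theorem differentiableAt_wedge {E : Type*} [NormedAddCommGroup E] [NormedSpace ℝ E]
    (h : k + l = n) {α : E → V [⋀^Fin k]→ₗ[ℝ] ℝ} {β : E → V [⋀^Fin l]→ₗ[ℝ] ℝ} {c : E}
    (hα : ∀ v, DifferentiableAt ℝ (fun x => α x v) c)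
    (hβ : ∀ v, DifferentiableAt ℝ (fun x => β x v) c) (v : Fin n → V) :
    DifferentiableAt ℝ (fun x => wedge h (α x) (β x) v) c := by
  simp only [wedge_apply, Units.smul_def, zsmul_eq_mul]
  fun_prop

end Wedge

section Derivation

variable {V : Type*} [AddCommGroup V] [Module ℝ V] {n : ℕ}

/-- The derivation `f ↦ A · f` of alternating forms induced by an endomorphism `A`, as a linear
function of `A`: antisymmetrizing `u, v ↦ f(A u, v)` gives `∑ᵢ f(v₁, …, A vᵢ, …, vₙ)`. -/
def derivation (f : V [⋀^Fin (n + 1)]→ₗ[ℝ] ℝ) : (V →ₗ[ℝ] V) →ₗ[ℝ] V [⋀^Fin (n + 1)]→ₗ[ℝ] ℝ :=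
  AlternatingMap.alternatizeUncurryFinLM ∘ₗ f.curryLeft.compRight ℝ

theorem derivation_apply (f : V [⋀^Fin (n + 1)]→ₗ[ℝ] ℝ) (A : V →ₗ[ℝ] V) (v : Fin (n + 1) → V) :
    derivation f A v = ∑ i, f (Function.update v i (A (v i))) := by
  refine (AlternatingMap.alternatizeUncurryFin_apply _ v).trans
    (Finset.sum_congr rfl fun i _ => ?_)
  rw [LinearMap.compRight_apply, LinearMap.comp_apply, AlternatingMap.curryLeft_apply_apply,
    ← AlternatingMap.map_insertNth, Fin.insertNth_removeNth]

theorem hasDerivAt_multilinearMap_add_smul {ι V F : Type*} [Fintype ι] [DecidableEq ι]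
    [AddCommGroup V] [Module ℝ V] [NormedAddCommGroup F] [NormedSpace ℝ F]
    (f : MultilinearMap ℝ (fun _ : ι => V) F) (v w : ι → V) :
    HasDerivAt (fun s : ℝ => f (v + s • w)) (f.linearDeriv v w) 0 := by
  have hexpand (s : ℝ) : f (v + s • w) = f v + s • f.linearDeriv v w
      + ∑ S : Finset ι with 2 ≤ S.card, s ^ S.card • f (S.piecewise w v) := by
    rw [f.map_add_eq_map_add_linearDeriv_add, map_smul]
    congr 1
    refine Finset.sum_congr rfl fun S _ => ?_
    have hpiecewise : S.piecewise (s • w) v =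
        S.piecewise (fun i => s • S.piecewise w v i) (S.piecewise w v) := by
      ext i
      by_cases hi : i ∈ S <;> simp [hi]
    rw [hpiecewise, f.map_piecewise_smul, Finset.prod_const]
  have hhigher : HasDerivAt (fun s : ℝ => ∑ S : Finset ι with 2 ≤ S.card,
      s ^ S.card • f (S.piecewise w v)) 0 0 := by
    refine (HasDerivAt.fun_sum fun S _ =>
      (hasDerivAt_pow S.card (0 : ℝ)).smul_const _).congr_deriv (Finset.sum_eq_zero fun S hS => ?_)
    have : 2 ≤ S.card := (Finset.mem_filter.1 hS).2
    simp [zero_pow (show S.card - 1 ≠ 0 by omega)]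
  simp only [hexpand]
  simpa using (((hasDerivAt_id (0 : ℝ)).smul_const (f.linearDeriv v w)).const_add (f v)).fun_add
    hhigher

theorem hasDerivAt_compLinearMap_id_add_smul (f : V [⋀^Fin (n + 1)]→ₗ[ℝ] ℝ) (A : V →ₗ[ℝ] V)
    (v : Fin (n + 1) → V) :
    HasDerivAt (fun s : ℝ => f.compLinearMap (LinearMap.id + s • A) v) (derivation f A v) 0 := by
  rw [derivation_apply]
  exact (hasDerivAt_multilinearMap_add_smul f.toMultilinearMap v (A ∘ v)).congr_deriv
    (MultilinearMap.linearDeriv_apply ..)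

end Derivation

section Frames

variable {V : Type*} [AddCommGroup V] [Module ℝ V] {N n : ℕ}

theorem ext_of_strictMono (b : Basis (Fin N) ℝ V) {f g : V [⋀^Fin n]→ₗ[ℝ] ℝ}
    (h : ∀ m : Fin n → Fin N, StrictMono m → f (b ∘ m) = g (b ∘ m)) : f = g := by
  refine b.ext_alternating fun m hm => ?_
  have hsort := h (m ∘ Tuple.sort m)
    ((Tuple.monotone_sort m).strictMono_of_injective (hm.comp (Tuple.sort m).injective))
  rw [← Function.comp_assoc, f.map_perm, g.map_perm] at hsort
  exact smul_left_cancel _ hsort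

theorem ext_three (b : Basis (Fin N) ℝ V) {f g : V [⋀^Fin 3]→ₗ[ℝ] ℝ}
    (h : ∀ i j k, i < j → j < k → f ![b i, b j, b k] = g ![b i, b j, b k]) : f = g := by
  refine ext_of_strictMono b fun m hm => ?_
  rw [← FinVec.etaExpand_eq (b ∘ m)]
  exact h _ _ _ (hm (by decide)) (hm (by decide))

theorem ext_four (b : Basis (Fin N) ℝ V) {f g : V [⋀^Fin 4]→ₗ[ℝ] ℝ}
    (h : ∀ i j k l, i < j → j < k → k < l →
      f ![b i, b j, b k, b l] = g ![b i, b j, b k, b l]) : f = g := by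
  refine ext_of_strictMono b fun m hm => ?_
  rw [← FinVec.etaExpand_eq (b ∘ m)]
  exact h _ _ _ _ (hm (by decide)) (hm (by decide)) (hm (by decide))

theorem derivation_toLin_basis {ι : Type*} [Fintype ι] [DecidableEq ι] (b : Basis ι ℝ V)
    (A : Matrix ι ι ℝ) (f : V [⋀^Fin (n + 1)]→ₗ[ℝ] ℝ) (m : Fin (n + 1) → ι) :
    derivation f (Matrix.toLin b b A) (b ∘ m) =
      ∑ p, ∑ i, A p (m i) * f (b ∘ Function.update m i p) := by
  rw [derivation_apply, Finset.sum_comm]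
  refine Finset.sum_congr rfl fun i _ => ?_
  simp only [Function.comp_apply, Matrix.toLin_self, f.map_update_sum, f.map_update_smul,
    Function.comp_update, smul_eq_mul]

theorem derivation_toLin_three {ι : Type*} [Fintype ι] [DecidableEq ι] (b : Basis ι ℝ V)
    (A : Matrix ι ι ℝ) (f : V [⋀^Fin 3]→ₗ[ℝ] ℝ) (i j k : ι) :
    derivation f (Matrix.toLin b b A) ![b i, b j, b k] =
      ∑ m, (A m i * f ![b m, b j, b k] + A m j * f ![b i, b m, b k]
        + A m k * f ![b i, b j, b m]) := by
  have hbasis (i j k : ι) : b ∘ ![i, j, k] = ![b i, b j, b k] := (FinVec.map_eq _ _).symm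
  have hupdate (m : ι) : Function.update ![i, j, k] 0 m = ![m, j, k] ∧
      Function.update ![i, j, k] 1 m = ![i, m, k] ∧
      Function.update ![i, j, k] 2 m = ![i, j, m] := by
    refine ⟨?_, ?_, ?_⟩ <;> funext t <;> fin_cases t <;> rfl
  rw [← hbasis, derivation_toLin_basis]
  simp [Fin.sum_univ_three, hupdate, hbasis]

theorem derivation_toLin_four {ι : Type*} [Fintype ι] [DecidableEq ι] (b : Basis ι ℝ V)
    (A : Matrix ι ι ℝ) (f : V [⋀^Fin 4]→ₗ[ℝ] ℝ) (i j k l : ι) :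
    derivation f (Matrix.toLin b b A) ![b i, b j, b k, b l] =
      ∑ m, (A m i * f ![b m, b j, b k, b l] + A m j * f ![b i, b m, b k, b l]
        + A m k * f ![b i, b j, b m, b l] + A m l * f ![b i, b j, b k, b m]) := by
  have hbasis (i j k l : ι) : b ∘ ![i, j, k, l] = ![b i, b j, b k, b l] :=
    (FinVec.map_eq _ _).symm
  have hupdate (m : ι) : Function.update ![i, j, k, l] 0 m = ![m, j, k, l] ∧
      Function.update ![i, j, k, l] 1 m = ![i, m, k, l] ∧
      Function.update ![i, j, k, l] 2 m = ![i, j, m, l] ∧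
      Function.update ![i, j, k, l] 3 m = ![i, j, k, m] := by
    refine ⟨?_, ?_, ?_, ?_⟩ <;> funext t <;> fin_cases t <;> rfl
  rw [← hbasis, derivation_toLin_basis]
  simp [Fin.sum_univ_four, hupdate, hbasis]

theorem alternatizeUncurryFin_four (F : V →ₗ[ℝ] V [⋀^Fin 3]→ₗ[ℝ] ℝ) (u v w x : V) :
    AlternatingMap.alternatizeUncurryFin F ![u, v, w, x] =
      F u ![v, w, x] - F v ![u, w, x] + F w ![u, v, x] - F x ![u, v, w] := by
  have hremove : Fin.removeNth 0 ![u, v, w, x] = ![v, w, x] ∧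
      Fin.removeNth 1 ![u, v, w, x] = ![u, w, x] ∧
      Fin.removeNth 2 ![u, v, w, x] = ![u, v, x] ∧
      Fin.removeNth 3 ![u, v, w, x] = ![u, v, w] := by
    refine ⟨?_, ?_, ?_, ?_⟩ <;> funext t <;> fin_cases t <;> rfl
  rw [AlternatingMap.alternatizeUncurryFin_apply, Fin.sum_univ_four]
  simp only [Fin.coe_ofNat_eq_mod, Nat.zero_mod, Nat.one_mod, Nat.reduceMod, Nat.mod_succ, pow_zero,
    pow_succ, mul_neg, mul_one, neg_neg, one_smul, neg_smul, Matrix.cons_val, hremove,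
    Nat.reduceAdd, Nat.succ_eq_add_one, Fin.isValue, Matrix.cons_val_zero, Matrix.cons_val_one]
  ring

end Frames

section Coefficients

/-- The coefficient of `eᵖ ∧ e^q` on the basis vectors with indices `i, j`. -/
def pairCoeff (p q i j : Fin 7) : ℤ :=
  (if p = i then if q = j then 1 else 0 else 0) - (if p = j then if q = i then 1 else 0 else 0)

/-- The coefficient of `eᵖ ∧ e^q ∧ eʳ` on the basis vectors with indices `i, j, k`. -/
def tripleCoeff (p q r i j k : Fin 7) : ℤ :=
  (if p = i then pairCoeff q r j k else 0) - (if p = j then pairCoeff q r i k else 0)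
    + (if p = k then pairCoeff q r i j else 0)

/-- The coefficient of `eᵖ ∧ e^q ∧ eʳ ∧ eˢ` on the basis vectors with indices `i, j, k, l`. -/
def quadCoeff (p q r s i j k l : Fin 7) : ℤ :=
  (if p = i then tripleCoeff q r s j k l else 0) - (if p = j then tripleCoeff q r s i k l else 0)
    + (if p = k then tripleCoeff q r s i j l else 0)
    - (if p = l then tripleCoeff q r s i j k else 0)

/-- The components of the model three-form. -/
def phiCoeff (i j k : Fin 7) : ℤ :=
  tripleCoeff 0 1 2 i j k + tripleCoeff 0 3 4 i j k + tripleCoeff 0 5 6 i j k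
    + tripleCoeff 1 3 5 i j k - tripleCoeff 1 4 6 i j k - tripleCoeff 2 3 6 i j k
    - tripleCoeff 2 4 5 i j k

/-- The components of the dual of the model three-form. -/
def psiCoeff (i j k l : Fin 7) : ℤ :=
  -quadCoeff 3 4 5 6 i j k l - quadCoeff 1 2 5 6 i j k l - quadCoeff 1 2 3 4 i j k l
    - quadCoeff 0 2 4 6 i j k l + quadCoeff 0 2 3 5 i j k l + quadCoeff 0 1 4 5 i j k l
    + quadCoeff 0 1 3 6 i j k l

theorem sum_phiCoeff_mul_phiCoeff : ∀ x i j k : Fin 7, i < j → j < k →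
    ∑ m, (phiCoeff x i m * phiCoeff m j k + phiCoeff x j m * phiCoeff i m k
      + phiCoeff x k m * phiCoeff i j m) = -3 * psiCoeff x i j k := by
  decide +kernel

theorem sum_phiCoeff_mul_psiCoeff : ∀ x i j k l : Fin 7, i < j → j < k → k < l →
    ∑ m, (phiCoeff x i m * psiCoeff m j k l + phiCoeff x j m * psiCoeff i m k l
      + phiCoeff x k m * psiCoeff i j m l + phiCoeff x l m * psiCoeff i j k m) =
    3 * ((if x = i then phiCoeff j k l else 0) - (if x = j then phiCoeff i k l else 0)
      + (if x = k then phiCoeff i j l else 0) - (if x = l then phiCoeff i j k else 0)) := by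
  decide +kernel

/-- Four times the components of `(u ⌟ φ) ∧ (v ⌟ φ)`, where `φ` is the model three-form and `u`,
`v` are the basis vectors with indices `x`, `y`. -/
def squareCoeff (x y : Fin 7) (m : Fin 4 → Fin 7) : ℤ :=
  ∑ σ : Equiv.Perm (Fin 4), Equiv.Perm.sign σ •
    (phiCoeff x (m (σ 0)) (m (σ 1)) * phiCoeff y (m (σ 2)) (m (σ 3)))

theorem sum_squareCoeff : ∀ x y : Fin 7,
    squareCoeff x y ![3, 4, 5, 6] + squareCoeff x y ![1, 2, 5, 6] + squareCoeff x y ![1, 2, 3, 4]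
      + squareCoeff x y ![0, 2, 4, 6] - squareCoeff x y ![0, 2, 3, 5]
      - squareCoeff x y ![0, 1, 4, 5] - squareCoeff x y ![0, 1, 3, 6] =
    if x = y then 24 else 0 := by
  decide +kernel

/-- The Levi-Civita symbol in dimension `n`. -/
def leviCivita {n : ℕ} (f : Fin n → Fin n) : ℤ :=
  ∏ i, ∏ j ∈ Finset.Ioi i, if f i < f j then 1 else if f j < f i then -1 else 0

theorem sum_phiCoeff_mul_leviCivita (i j k l : Fin 7) (hij : i < j) (hjk : j < k) (hkl : k < l) :
    ∑ p, ∑ q, ∑ r, phiCoeff p q r * leviCivita ![p, q, r, i, j, k, l] = -6 * psiCoeff i j k l := by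
  -- skipping the terms with `φ_pqr = 0` keeps the kernel computation short
  have hsparse : ∀ i j k l : Fin 7, i < j → j < k → k < l →
      ∑ p, ∑ q, ∑ r, (if phiCoeff p q r = 0 then 0 else
        phiCoeff p q r * leviCivita ![p, q, r, i, j, k, l]) = -6 * psiCoeff i j k l := by
    decide +kernel
  rw [← hsparse i j k l hij hjk hkl]
  refine Finset.sum_congr rfl fun p _ => Finset.sum_congr rfl fun q _ =>
    Finset.sum_congr rfl fun r _ => ?_
  split_ifs with h <;> simp [h]

end Coefficients

section LeviCivita

theorem leviCivita_perm {n : ℕ} (σ : Equiv.Perm (Fin n)) :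
    leviCivita σ = Equiv.Perm.sign σ := by
  rw [Equiv.Perm.sign_eq_prod_prod_Ioi, leviCivita]
  push_cast
  refine Finset.prod_congr rfl fun i _ => Finset.prod_congr rfl fun j hj => ?_
  rcases lt_or_gt_of_ne (σ.injective.ne (Finset.mem_Ioi.1 hj).ne) with h | h <;> simp [h, h.asymm]

theorem leviCivita_eq_zero {n : ℕ} {f : Fin n → Fin n} (hf : ¬ Function.Injective f) :
    leviCivita f = 0 := by
  obtain ⟨i, j, hij, h⟩ : ∃ i j, i < j ∧ f i = f j := by
    contrapose! hf
    exact .of_lt_imp_ne hf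
  exact Finset.prod_eq_zero (Finset.mem_univ i)
    (Finset.prod_eq_zero (Finset.mem_Ioi.2 hij) (by simp [h]))

theorem map_comp_eq_leviCivita_mul {V : Type*} [AddCommGroup V] [Module ℝ V] {n : ℕ}
    (F : V [⋀^Fin n]→ₗ[ℝ] ℝ) (v : Fin n → V) (f : Fin n → Fin n) :
    F (v ∘ f) = leviCivita f * F v := by
  by_cases hf : Function.Injective f
  · obtain ⟨σ, rfl⟩ : ∃ σ : Equiv.Perm (Fin n), ⇑σ = f :=
      ⟨Equiv.ofBijective f (Finite.injective_iff_bijective.1 hf), rfl⟩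
    rw [leviCivita_perm, F.map_perm, Units.smul_def, zsmul_eq_mul]
  · rw [leviCivita_eq_zero hf, F.map_eq_zero_of_not_injective _ fun h => hf h.of_comp,
      Int.cast_zero, zero_mul]

end LeviCivita

section Model

variable {V : Type*} [AddCommGroup V] [Module ℝ V] (b : Basis (Fin 7) ℝ V)

theorem dualTriple_basis (p q r i j k : Fin 7) :
    dualTriple b p q r ![b i, b j, b k] = tripleCoeff p q r i j k := by
  simp only [dualTriple, AlternatingMap.compLinearMap_apply]
  refine (Matrix.det_fin_three _).trans ?_
  simp only [Matrix.cons_val, Matrix.cons_val_zero, Matrix.cons_val_one, LinearMap.pi_apply,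
    Basis.coord_apply, Basis.repr_self, Finsupp.single_apply, eq_comm (b := p), eq_comm (b := q),
    eq_comm (b := r), tripleCoeff, pairCoeff, Int.cast_add, Int.cast_sub, Int.cast_ite,
    Int.cast_one, Int.cast_zero, mul_ite, mul_one, mul_zero]
  split_ifs <;> norm_num

theorem modelForm_basis (i j k : Fin 7) :
    modelForm b ![b i, b j, b k] = phiCoeff i j k := by
  simp [modelForm, phiCoeff, dualTriple_basis]

/-- The decomposable four-form `eᵖ ∧ e^q ∧ eʳ ∧ eˢ` built from the basis dual to `b`. -/
def dualQuad (p q r s : Fin 7) : V [⋀^Fin 4]→ₗ[ℝ] ℝ :=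
  AlternatingMap.alternatizeUncurryFin ((b.coord p).smulRight (dualTriple b q r s))

theorem dualQuad_basis (p q r s i j k l : Fin 7) :
    dualQuad b p q r s ![b i, b j, b k, b l] = quadCoeff p q r s i j k l := by
  rw [dualQuad, alternatizeUncurryFin_four]
  simp only [LinearMap.smulRight_apply, AlternatingMap.smul_apply, dualTriple_basis]
  simp [quadCoeff, Finsupp.single_apply, eq_comm (b := p)]

/-- The dual four-form of the model three-form, see `dualForm_modelForm`. It is the negative of the
usual `e⁴⁵⁶⁷ + ⋯`, because `b` is negatively oriented. -/
def modelDual : V [⋀^Fin 4]→ₗ[ℝ] ℝ :=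
  -dualQuad b 3 4 5 6 - dualQuad b 1 2 5 6 - dualQuad b 1 2 3 4 - dualQuad b 0 2 4 6
    + dualQuad b 0 2 3 5 + dualQuad b 0 1 4 5 + dualQuad b 0 1 3 6

theorem modelDual_basis (i j k l : Fin 7) :
    modelDual b ![b i, b j, b k, b l] = psiCoeff i j k l := by
  simp [modelDual, psiCoeff, dualQuad_basis]

theorem wedge_dualTriple_comp (γ : V [⋀^Fin 4]→ₗ[ℝ] ℝ) {f : Fin 7 → Fin 7}
    (hf : Function.Injective f) :
    wedge (show 4 + 3 = 7 from rfl) γ (dualTriple b (f 4) (f 5) (f 6)) (b ∘ f) =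
      γ ![b (f 0), b (f 1), b (f 2), b (f 3)] := by
  have hα : (fun i : Fin 4 => b (f (Fin.castAdd 3 i))) = ![b (f 0), b (f 1), b (f 2), b (f 3)] :=
    (FinVec.etaExpand_eq _).symm
  have hβ : (fun i : Fin 3 => b (f (Fin.natAdd 4 i))) = ![b (f 4), b (f 5), b (f 6)] :=
    (FinVec.etaExpand_eq _).symm
  rw [wedge_eq_single]
  · refine (congrArg₂ (γ · * dualTriple b (f 4) (f 5) (f 6) ·) hα hβ).trans ?_
    rw [dualTriple_basis]
    simp [tripleCoeff, pairCoeff, hf.eq_iff]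
  · intro σ x y hxy
    refine Matrix.det_eq_zero_of_row_eq_zero x fun c => ?_
    have hne (m : Fin 3) : f (Fin.castAdd 3 y) ≠ f (Fin.natAdd 4 m) :=
      hf.ne (Fin.ne_of_lt (y.2.trans_le (Nat.le_add_right 4 m)))
    have hzero (m : Fin 3) : b.coord (f (Fin.natAdd 4 m)) (b (f (Fin.castAdd 3 y))) = 0 := by
      simp [hne]
    change (![b.coord (f 4), b.coord (f 5), b.coord (f 6)] c)
      (b (f (finCongr _ (finSumFinEquiv (σ (Sum.inr x)))))) = 0
    rw [hxy]
    fin_cases c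
    exacts [hzero 0, hzero 1, hzero 2]

theorem wedge_dualTriple_basis (γ : V [⋀^Fin 4]→ₗ[ℝ] ℝ) {f : Fin 7 → Fin 7}
    (hf : leviCivita f = 1) :
    wedge (show 4 + 3 = 7 from rfl) γ (dualTriple b (f 4) (f 5) (f 6)) b =
      γ ![b (f 0), b (f 1), b (f 2), b (f 3)] := by
  have hinj : Function.Injective f := by
    contrapose! hf
    simp [leviCivita_eq_zero hf]
  rw [← wedge_dualTriple_comp b γ hinj, map_comp_eq_leviCivita_mul, hf, Int.cast_one, one_mul]

theorem wedge_modelForm_basis (γ : V [⋀^Fin 4]→ₗ[ℝ] ℝ) :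
    wedge (show 4 + 3 = 7 from rfl) γ (modelForm b) b =
      γ ![b 3, b 4, b 5, b 6] + γ ![b 1, b 2, b 5, b 6] + γ ![b 1, b 2, b 3, b 4]
      + γ ![b 0, b 2, b 4, b 6] - γ ![b 0, b 2, b 3, b 5] - γ ![b 0, b 1, b 4, b 5]
      - γ ![b 0, b 1, b 3, b 6] := by
  have h012 := wedge_dualTriple_basis b γ (f := ![3, 4, 5, 6, 0, 1, 2]) (by decide +kernel)
  have h034 := wedge_dualTriple_basis b γ (f := ![1, 2, 5, 6, 0, 3, 4]) (by decide +kernel)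
  have h056 := wedge_dualTriple_basis b γ (f := ![1, 2, 3, 4, 0, 5, 6]) (by decide +kernel)
  have h135 := wedge_dualTriple_basis b γ (f := ![0, 2, 4, 6, 1, 3, 5]) (by decide +kernel)
  have h146 := wedge_dualTriple_basis b γ (f := ![0, 2, 3, 5, 1, 4, 6]) (by decide +kernel)
  have h236 := wedge_dualTriple_basis b γ (f := ![0, 1, 4, 5, 2, 3, 6]) (by decide +kernel)
  have h245 := wedge_dualTriple_basis b γ (f := ![0, 1, 3, 6, 2, 4, 5]) (by decide +kernel)
  simp only [Matrix.cons_val, ← wedgeHom_apply, ← evalAt_apply b]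
    at h012 h034 h056 h135 h146 h236 h245
  rw [← wedgeHom_apply, modelForm, ← evalAt_apply]
  simp only [map_add, map_sub, h012, h034, h056, h135, h146, h236, h245]

theorem wedge_curryLeft_modelForm_basis (x y : Fin 7) (m : Fin 4 → Fin 7) :
    wedge (show 2 + 2 = 4 from rfl) ((modelForm b).curryLeft (b x)) ((modelForm b).curryLeft (b y))
      (b ∘ m) = squareCoeff x y m / 4 := by
  have hpair (x : Fin 7) (i : Fin 2 → Fin 7) :
      (modelForm b).curryLeft (b x) (b ∘ i) = phiCoeff x (i 0) (i 1) := by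
    rw [← modelForm_basis b, AlternatingMap.curryLeft_apply_apply]
    exact congrArg (fun v => modelForm b (Matrix.vecCons (b x) v))
      (FinVec.etaExpand_eq (b ∘ i)).symm
  rw [wedge_apply, squareCoeff, div_eq_inv_mul]
  push_cast [Units.smul_def, zsmul_eq_mul]
  congr 1
  · norm_num [Nat.factorial]
  · refine Finset.sum_congr rfl fun σ _ => ?_
    congr 1
    exact congrArg₂ (· * ·) (hpair x _) (hpair y _)

theorem topForm_modelForm_basis (x y : Fin 7) :
    topForm (modelForm b) (b x) (b y) b = if x = y then 6 else 0 := by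
  have hwedge (i j k l : Fin 7) : wedge (show 2 + 2 = 4 from rfl) ((modelForm b).curryLeft (b x))
      ((modelForm b).curryLeft (b y)) ![b i, b j, b k, b l] =
      squareCoeff x y ![i, j, k, l] / 4 := by
    rw [← wedge_curryLeft_modelForm_basis b]
    exact congrArg (wedge _ _ _) (FinVec.map_eq b ![i, j, k, l])
  have hsum := congrArg (Int.cast (R := ℝ)) (sum_squareCoeff x y)
  push_cast at hsum
  rw [topForm, wedge_modelForm_basis]
  simp only [hwedge, ← add_div, ← sub_div, hsum]
  split_ifs <;> norm_num

theorem matrixB_modelForm : matrixB b (modelForm b) = (6 : ℝ) • 1 := by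
  ext i j
  simp [matrixB_apply, topForm_modelForm_basis, Matrix.one_apply]

theorem ninthRoot_det_modelForm :
    ninthRoot (matrixB b (modelForm b)).det = (6 : ℝ) ^ (7 / 9 : ℝ) := by
  rw [matrixB_modelForm, Matrix.det_smul, Matrix.det_one, mul_one, Fintype.card_fin, ninthRoot,
    Real.sign_of_pos (by positivity), one_mul, abs_of_pos (by positivity), ← Real.rpow_natCast,
    ← Real.rpow_mul (by norm_num)]
  norm_num

theorem metric_modelForm_basis (i j : Fin 7) :
    metric b (modelForm b) (b i) (b j) = if i = j then 1 else 0 := by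
  have hscale : (6 : ℝ) ^ (-(2 / 9) : ℝ) * (6 / 6 ^ (7 / 9 : ℝ)) = 1 := by
    rw [← mul_div_assoc, div_eq_one_iff_eq (by positivity), ← Real.rpow_add_one (by norm_num)]
    norm_num
  rw [metric, topForm_modelForm_basis, ninthRoot_det_modelForm]
  split_ifs
  · exact hscale
  · simp

theorem volumeForm_modelForm : volumeForm b (modelForm b) = -b.det := by
  have hscale : (6 : ℝ) ^ (-(7 / 9) : ℝ) * 6 ^ (7 / 9 : ℝ) = 1 := by
    rw [← Real.rpow_add (by norm_num), neg_add_cancel, Real.rpow_zero]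
  rw [volumeForm, ninthRoot_det_modelForm, hscale]
  exact neg_one_smul ℝ b.det

theorem raised_modelForm (a : Fin 7) : raised (metric b (modelForm b)) b a = b a := by
  have hgram : gram (metric b (modelForm b)) b = 1 := by
    ext i j
    rw [gram, metric_modelForm_basis, Matrix.one_apply]
  simp [raised, hgram, Matrix.one_apply]

theorem hodgeStar_apply (e : Fin 7 → V) (g : V → V → ℝ) (vol : V [⋀^Fin 7]→ₗ[ℝ] ℝ)
    (β : V [⋀^Fin 3]→ₗ[ℝ] ℝ) (v : Fin 4 → V) :
    hodgeStar g vol e β v = 1 / 6 * ∑ i, ∑ j, ∑ k, β ![e i, e j, e k] *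
      vol (Matrix.vecCons (raised g e i) (Matrix.vecCons (raised g e j)
        (Matrix.vecCons (raised g e k) v))) := by
  rw [← evalAt_apply, hodgeStar]
  simp only [map_smul, map_sum, evalAt_apply, AlternatingMap.curryLeft_apply_apply, smul_eq_mul]

theorem dualForm_modelForm : dualForm b (modelForm b) = modelDual b := by
  refine ext_four b fun i j k l hij hjk hkl => ?_
  have hvol (p q r : Fin 7) :
      b.det ![b p, b q, b r, b i, b j, b k, b l] = leviCivita ![p, q, r, i, j, k, l] := by
    rw [← mul_one (leviCivita ![p, q, r, i, j, k, l] : ℝ), ← b.det_self,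
      ← map_comp_eq_leviCivita_mul]
    exact congrArg b.det (FinVec.map_eq b ![p, q, r, i, j, k, l])
  have hsum := congrArg (Int.cast (R := ℝ)) (sum_phiCoeff_mul_leviCivita i j k l hij hjk hkl)
  push_cast at hsum
  simp only [dualForm, hodgeStar_apply, raised_modelForm, volumeForm_modelForm, modelForm_basis,
    modelDual_basis, AlternatingMap.neg_apply, hvol, mul_neg, Finset.sum_neg_distrib, hsum]
  ring

end Model

section Cross

variable {V : Type*} [AddCommGroup V] [Module ℝ V] (b : Basis (Fin 7) ℝ V)

/-- The metric of a three-form as a bilinear form. -/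
def metricForm (φ : V [⋀^Fin 3]→ₗ[ℝ] ℝ) : LinearMap.BilinForm ℝ V :=
  LinearMap.mk₂ ℝ (metric b φ)
    (fun u u' v => by
      simp [metric, topForm, ← wedgeHom_apply, add_div, mul_add])
    (fun c u v => by
      simp [metric, topForm, ← wedgeHom_apply, mul_div_assoc, mul_left_comm])
    (fun u v v' => by
      simp [metric, topForm, ← wedgeHom_apply, add_div, mul_add])
    (fun c u v => by
      simp [metric, topForm, ← wedgeHom_apply, mul_div_assoc, mul_left_comm])

theorem metricForm_apply (φ : V [⋀^Fin 3]→ₗ[ℝ] ℝ) (u v : V) :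
    metricForm b φ u v = metric b φ u v := rfl

theorem metricForm_modelForm : metricForm b (modelForm b) = b.toDual :=
  b.ext fun i => b.ext fun j => by
    rw [metricForm_apply, metric_modelForm_basis, Basis.toDual_apply]

/-- The endomorphism `u ↦ -(1/3) X × u`, linear in `X`, where `×` is the cross product of the model
three-form in the basis `b`. -/
def crossEnd : V →ₗ[ℝ] V →ₗ[ℝ] V :=
  b.constr ℝ fun a => Matrix.toLin b b (.of fun m i => -(1 / 3) * phiCoeff a i m)

theorem derivation_modelForm_crossEnd (X : V) :
    derivation (modelForm b) (crossEnd b X) = (modelDual b).curryLeft X := by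
  suffices h : derivation (modelForm b) ∘ₗ crossEnd b =
      AlternatingMap.curryLeftLinearMap (modelDual b) from LinearMap.congr_fun h X
  refine b.ext fun a => ext_three b fun i j k hij hjk => ?_
  have hsum := congrArg (Int.cast (R := ℝ)) (sum_phiCoeff_mul_phiCoeff a i j k hij hjk)
  push_cast at hsum
  rw [LinearMap.comp_apply, crossEnd, b.constr_basis, derivation_toLin_three,
    AlternatingMap.curryLeftLinearMap_apply, AlternatingMap.curryLeft_apply_apply]
  simp only [modelForm_basis, modelDual_basis, Matrix.of_apply, mul_assoc, ← mul_add,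
    ← Finset.mul_sum, hsum]
  ring

theorem derivation_modelDual_crossEnd (X : V) :
    derivation (modelDual b) (crossEnd b X) =
      -AlternatingMap.alternatizeUncurryFin ((b.toDual X).smulRight (modelForm b)) := by
  suffices h : derivation (modelDual b) ∘ₗ crossEnd b = -(AlternatingMap.alternatizeUncurryFinLM ∘ₗ
      LinearMap.smulRightₗ.flip (modelForm b) ∘ₗ b.toDual) from LinearMap.congr_fun h X
  refine b.ext fun a => ext_four b fun i j k l hij hjk hkl => ?_
  have hsum := congrArg (Int.cast (R := ℝ)) (sum_phiCoeff_mul_psiCoeff a i j k l hij hjk hkl)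
  push_cast at hsum
  rw [LinearMap.comp_apply, crossEnd, b.constr_basis, derivation_toLin_four]
  simp only [modelDual_basis, Matrix.of_apply, mul_assoc, ← mul_add, ← Finset.mul_sum, hsum]
  change _ = -AlternatingMap.alternatizeUncurryFin ((b.toDual (b a)).smulRight (modelForm b)) _
  simp only [alternatizeUncurryFin_four, LinearMap.smulRight_apply, AlternatingMap.smul_apply,
    modelForm_basis, Basis.toDual_apply, smul_eq_mul, ite_mul, one_mul, zero_mul]
  ring

theorem exists_derivation_eq_curryLeft {φ : V [⋀^Fin 3]→ₗ[ℝ] ℝ} (hφ : IsPositive φ) (X : V) :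
    ∃ C : V →ₗ[ℝ] V, derivation φ C = (dualForm b φ).curryLeft X ∧
      derivation (dualForm b φ) C =
        -AlternatingMap.alternatizeUncurryFin (((metricForm b φ).flip X).smulRight φ) := by
  obtain ⟨b', rfl⟩ := hφ
  have hflat : (metricForm b (modelForm b')).flip X = b'.toDual X := by
    refine b'.ext fun i => ?_
    rw [LinearMap.BilinForm.flip_apply, metricForm_apply, metric_eq b' b, ← metricForm_apply,
      metricForm_modelForm, Basis.toDual_apply_left, Basis.toDual_apply_right]
  rw [dualForm_eq b' b, dualForm_modelForm, hflat]
  exact ⟨crossEnd b' X, derivation_modelForm_crossEnd b' X, derivation_modelDual_crossEnd b' X⟩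

end Cross

section Equivariance

variable {V W : Type*} [AddCommGroup V] [Module ℝ V] [AddCommGroup W] [Module ℝ W]

theorem topForm_compLinearMap (φ : V [⋀^Fin 3]→ₗ[ℝ] ℝ) (f : W →ₗ[ℝ] V) (u v : W) :
    topForm (φ.compLinearMap f) u v = (topForm φ (f u) (f v)).compLinearMap f := by
  rw [topForm, topForm, ← wedge_compLinearMap, ← wedge_compLinearMap,
    AlternatingMap.curryLeft_compLinearMap, AlternatingMap.curryLeft_compLinearMap]

variable (b : Basis (Fin 7) ℝ V) (φ : V [⋀^Fin 3]→ₗ[ℝ] ℝ) (f : W ≃ₗ[ℝ] V)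

theorem matrixB_compLinearMap :
    matrixB (b.map f.symm) (φ.compLinearMap (f : W →ₗ[ℝ] V)) = matrixB b φ := by
  ext i j
  simp only [matrixB_apply, topForm_compLinearMap, AlternatingMap.compLinearMap_apply]
  simp

theorem metric_compLinearMap (u v : W) :
    metric (b.map f.symm) (φ.compLinearMap (f : W →ₗ[ℝ] V)) u v = metric b φ (f u) (f v) := by
  simp [metric, matrixB_compLinearMap, topForm_compLinearMap]

theorem volumeForm_compLinearMap :
    volumeForm (b.map f.symm) (φ.compLinearMap (f : W →ₗ[ℝ] V)) =
      (volumeForm b φ).compLinearMap (f : W →ₗ[ℝ] V) := by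
  rw [volumeForm, volumeForm, matrixB_compLinearMap, Basis.det_map']
  ext v
  simp [AlternatingMap.smul_apply]

theorem map_raised_compLinearMap (a : Fin 7) :
    f (raised (metric (b.map f.symm) (φ.compLinearMap (f : W →ₗ[ℝ] V))) (b.map f.symm) a) =
      raised (metric b φ) b a := by
  have hgram : gram (metric (b.map f.symm) (φ.compLinearMap (f : W →ₗ[ℝ] V))) (b.map f.symm) =
      gram (metric b φ) b := by
    ext i j
    simp [gram, metric_compLinearMap]
  simp [raised, hgram]

theorem dualForm_map_compLinearMap :
    dualForm (b.map f.symm) (φ.compLinearMap (f : W →ₗ[ℝ] V)) =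
      (dualForm b φ).compLinearMap (f : W →ₗ[ℝ] V) := by
  ext v
  have hmap {n : ℕ} (u : W) (w : Fin n → W) :
      (fun i => f (Matrix.vecCons u w i)) = Matrix.vecCons (f u) (fun i => f (w i)) :=
    (Fin.comp_cons f u w)
  simp only [dualForm, hodgeStar_apply, volumeForm_compLinearMap,
    AlternatingMap.compLinearMap_apply, LinearEquiv.coe_coe, hmap, map_raised_compLinearMap,
    Basis.map_apply, LinearEquiv.apply_symm_apply]
  simp [Matrix.empty_eq]

theorem dualForm_compLinearMap (b' : Basis (Fin 7) ℝ W) :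
    dualForm b' (φ.compLinearMap (f : W →ₗ[ℝ] V)) =
      (dualForm b φ).compLinearMap (f : W →ₗ[ℝ] V) :=
  (dualForm_eq _ _ _).trans (dualForm_map_compLinearMap b φ f)

end Equivariance

section Differentiability

variable {E : Type*} [NormedAddCommGroup E] [NormedSpace ℝ E] {c : E}

theorem differentiableAt_matrix_det {n : Type*} [Fintype n] [DecidableEq n] {A : E → Matrix n n ℝ}
    (hA : ∀ i j, DifferentiableAt ℝ (fun x => A x i j) c) :
    DifferentiableAt ℝ (fun x => (A x).det) c := by
  simp only [Matrix.det_apply, Units.smul_def, zsmul_eq_mul]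
  fun_prop

theorem differentiableAt_matrix_inv {n : Type*} [Fintype n] [DecidableEq n] {A : E → Matrix n n ℝ}
    (hA : ∀ i j, DifferentiableAt ℝ (fun x => A x i j) c) (hdet : (A c).det ≠ 0) (i j : n) :
    DifferentiableAt ℝ (fun x => (A x)⁻¹ i j) c := by
  simp only [Matrix.inv_def, Matrix.smul_apply, smul_eq_mul, Matrix.adjugate_apply,
    Ring.inverse_eq_inv']
  refine ((differentiableAt_matrix_det hA).inv hdet).mul (differentiableAt_matrix_det fun k l => ?_)
  rcases eq_or_ne k j with rfl | hk
  · simp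
  · simpa [Matrix.updateRow_ne hk] using hA k l

theorem differentiableAt_ninthRoot {x : ℝ} (hx : x ≠ 0) : DifferentiableAt ℝ ninthRoot x := by
  have habs : DifferentiableAt ℝ (fun y : ℝ => |y| ^ (1 / 9 : ℝ)) x :=
    (differentiableAt_abs hx).rpow_const (Or.inl (abs_ne_zero.2 hx))
  rcases hx.lt_or_gt with hneg | hpos
  · refine (habs.const_mul (-1)).congr_of_eventuallyEq ?_
    filter_upwards [eventually_lt_nhds hneg] with y hy
    rw [ninthRoot, Real.sign_of_neg hy]
  · refine (habs.const_mul 1).congr_of_eventuallyEq ?_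
    filter_upwards [eventually_gt_nhds hpos] with y hy
    rw [ninthRoot, Real.sign_of_pos hy]

theorem ninthRoot_ne_zero {x : ℝ} (hx : x ≠ 0) : ninthRoot x ≠ 0 :=
  mul_ne_zero (by simpa using hx) (Real.rpow_pos_of_pos (abs_pos.2 hx) _).ne'

variable {V : Type*} [AddCommGroup V] [Module ℝ V]

theorem differentiableAt_topForm {φ : E → V [⋀^Fin 3]→ₗ[ℝ] ℝ}
    (hφ : ∀ w, DifferentiableAt ℝ (fun x => φ x w) c) (u v : V) (w : Fin 7 → V) :
    DifferentiableAt ℝ (fun x => topForm (φ x) u v w) c := by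
  have hcurry (u : V) (w : Fin 2 → V) :
      DifferentiableAt ℝ (fun x => (φ x).curryLeft u w) c := by
    simp only [AlternatingMap.curryLeft_apply_apply]
    exact hφ _
  simp only [topForm]
  apply differentiableAt_wedge
  · apply differentiableAt_wedge
    · apply hcurry
    · apply hcurry
  · exact hφ

theorem det_gram_metric_ne_zero (b : Basis (Fin 7) ℝ V) {φ : V [⋀^Fin 3]→ₗ[ℝ] ℝ}
    (hB : (matrixB b φ).det ≠ 0) : (gram (metric b φ) b).det ≠ 0 := by
  have hgram : gram (metric b φ) b =
      ((6 : ℝ) ^ (-(2 / 9) : ℝ) / ninthRoot (matrixB b φ).det) • matrixB b φ := by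
    ext i j
    rw [gram, metric, Matrix.smul_apply, matrixB_apply, smul_eq_mul]
    ring
  rw [hgram, Matrix.det_smul]
  exact mul_ne_zero (pow_ne_zero _ (div_ne_zero (by positivity) (ninthRoot_ne_zero hB))) hB

theorem dualForm_apply (b : Basis (Fin 7) ℝ V) (φ : V [⋀^Fin 3]→ₗ[ℝ] ℝ) (v : Fin 4 → V) :
    dualForm b φ v = 1 / 6 * ∑ i, ∑ j, ∑ k, φ ![b i, b j, b k] *
      (-((6 : ℝ) ^ (-(7 / 9) : ℝ) * ninthRoot (matrixB b φ).det) * ∑ p, ∑ q, ∑ r,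
        (gram (metric b φ) b)⁻¹ k p * ((gram (metric b φ) b)⁻¹ j q *
          ((gram (metric b φ) b)⁻¹ i r * b.det (Matrix.vecCons (b r) (Matrix.vecCons (b q)
            (Matrix.vecCons (b p) v)))))) := by
  rw [dualForm, hodgeStar_apply, volumeForm]
  congr! with i _ j _ k _
  simp only [AlternatingMap.smul_apply, smul_eq_mul, raised,
    ← AlternatingMap.curryLeft_apply_apply, ← evalAt_apply v]
  simp only [← AlternatingMap.curryLeftLinearMap_apply, map_sum, map_smul, LinearMap.sum_apply,
    LinearMap.smul_apply, smul_eq_mul]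
  simp only [Finset.mul_sum]

variable (b : Basis (Fin 7) ℝ V) {φ : E → V [⋀^Fin 3]→ₗ[ℝ] ℝ}

theorem differentiableAt_ninthRoot_matrixB (hφ : ∀ w, DifferentiableAt ℝ (fun x => φ x w) c)
    (hB : (matrixB b (φ c)).det ≠ 0) :
    DifferentiableAt ℝ (fun x => ninthRoot (matrixB b (φ x)).det) c :=
  (differentiableAt_ninthRoot hB).comp c (f := fun x => (matrixB b (φ x)).det)
    (differentiableAt_matrix_det fun i j => differentiableAt_topForm hφ (b i) (b j) b)

theorem differentiableAt_metric (hφ : ∀ w, DifferentiableAt ℝ (fun x => φ x w) c)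
    (hB : (matrixB b (φ c)).det ≠ 0) (u v : V) :
    DifferentiableAt ℝ (fun x => metric b (φ x) u v) c := by
  have htop := differentiableAt_topForm hφ u v b
  have hroot := differentiableAt_ninthRoot_matrixB b hφ hB
  have hne := ninthRoot_ne_zero hB
  simp only [metric]
  fun_prop (disch := assumption)

theorem differentiableAt_dualForm (hφ : ∀ w, DifferentiableAt ℝ (fun x => φ x w) c)
    (hB : (matrixB b (φ c)).det ≠ 0) (v : Fin 4 → V) :
    DifferentiableAt ℝ (fun x => dualForm b (φ x) v) c := by
  have hroot := differentiableAt_ninthRoot_matrixB b hφ hB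
  have hinv := differentiableAt_matrix_inv (A := fun x => gram (metric b (φ x)) b)
    (fun i j => differentiableAt_metric b hφ hB (b i) (b j)) (det_gram_metric_ne_zero b hB)
  simp only [dualForm_apply]
  exact .const_mul (.fun_sum fun i _ => .fun_sum fun j _ => .fun_sum fun k _ => (hφ _).fun_mul <|
    (hroot.const_mul _).fun_neg.fun_mul <| .fun_sum fun p _ => .fun_sum fun q _ => .fun_sum
      fun r _ => (hinv k p).fun_mul <| (hinv j q).fun_mul <| (hinv i r).mul_const _) _

end Differentiability

section Flow

variable {V : Type*} [AddCommGroup V] [Module ℝ V]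

theorem det_matrixB_ne_zero (b : Basis (Fin 7) ℝ V) {φ : V [⋀^Fin 3]→ₗ[ℝ] ℝ} (hφ : IsPositive φ) :
    (matrixB b φ).det ≠ 0 := by
  obtain ⟨b', rfl⟩ := hφ
  intro hdet
  have hroot := ninthRoot_matrixB b' b (modelForm b')
  rw [hdet, ninthRoot_det_modelForm, ninthRoot, Real.sign_zero, zero_mul, eq_comm] at hroot
  exact mul_ne_zero (b'.isUnit_det b).ne_zero (by positivity) hroot

/-- The components of an alternating form in a basis. The target is a normed space, which makes
calculus available on the space of alternating forms. -/
def components {ι : Type*} (b : Basis ι ℝ V) (n : ℕ) :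
    (V [⋀^Fin n]→ₗ[ℝ] ℝ) →ₗ[ℝ] (Fin n → ι) → ℝ :=
  LinearMap.pi fun m => evalAt (b ∘ m)

theorem components_injective {ι : Type*} (b : Basis ι ℝ V) (n : ℕ) :
    Function.Injective (components b n) :=
  fun _ _ h => b.ext_alternating fun m _ => congrFun h m

theorem eventually_det_id_add_smul_ne_zero [FiniteDimensional ℝ V] (A : V →ₗ[ℝ] V) :
    ∀ᶠ s : ℝ in nhds 0, LinearMap.det (LinearMap.id + s • A) ≠ 0 := by
  have hcont : Continuous fun s : ℝ => LinearMap.det (LinearMap.id + s • A) := by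
    simp only [← LinearMap.det_toMatrix (finBasis ℝ V), map_add, map_smul]
    fun_prop
  exact hcont.continuousAt.eventually_ne (by simp)

theorem eventually_dualForm_compLinearMap (b : Basis (Fin 7) ℝ V) (φ : V [⋀^Fin 3]→ₗ[ℝ] ℝ)
    (A : V →ₗ[ℝ] V) : ∀ᶠ s : ℝ in nhds 0,
      dualForm b (φ.compLinearMap (LinearMap.id + s • A)) =
        (dualForm b φ).compLinearMap (LinearMap.id + s • A) := by
  have := b.finiteDimensional_of_finite
  filter_upwards [eventually_det_id_add_smul_ne_zero A] with s hs
  exact dualForm_compLinearMap b φ (LinearMap.equivOfDetNeZero _ hs) b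

theorem hasDerivWithinAt_dualForm (b : Basis (Fin 7) ℝ V) {φ : ℝ → V [⋀^Fin 3]→ₗ[ℝ] ℝ}
    {J : Set ℝ} {t : ℝ} (hB : (matrixB b (φ t)).det ≠ 0) (A : V →ₗ[ℝ] V)
    (hφ : ∀ m : Fin 3 → Fin 7,
      HasDerivWithinAt (fun s => φ s (b ∘ m)) (derivation (φ t) A (b ∘ m)) J t) (v : Fin 4 → V) :
    HasDerivWithinAt (fun s => dualForm b (φ s) v) (derivation (dualForm b (φ t)) A v) J t := by
  obtain ⟨R, hR⟩ := LinearMap.exists_leftInverse_of_injective (components b 3)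
    (LinearMap.ker_eq_bot.2 (components_injective b 3))
  replace hR (α) : R (components b 3 α) = α := LinearMap.congr_fun hR α
  let γ (s : ℝ) : V [⋀^Fin 3]→ₗ[ℝ] ℝ := (φ t).compLinearMap (LinearMap.id + s • A)
  have hγ0 : γ 0 = φ t := by
    simp only [γ, zero_smul, add_zero, AlternatingMap.compLinearMap_id]
  have hdual : HasFDerivAt (fun x => dualForm b (R x) v) _ (components b 3 (φ t)) :=
    (differentiableAt_dualForm b
      (fun w => (LinearMap.toContinuousLinearMap (evalAt w ∘ₗ R)).differentiableAt)
      (by rwa [hR]) v).hasFDerivAt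
  have hflow := hdual.comp_hasDerivWithinAt t (f := fun s => components b 3 (φ s))
    (hasDerivWithinAt_pi.2 hφ)
  have horbit := HasFDerivAt.comp_hasDerivAt (0 : ℝ) (f := fun s => components b 3 (γ s))
    (by rwa [hγ0]) (hasDerivAt_pi.2 fun m => hasDerivAt_compLinearMap_id_add_smul (φ t) A (b ∘ m))
  have hequivariant :
      HasDerivAt (fun s => dualForm b (γ s) v) (derivation (dualForm b (φ t)) A v) 0 :=
    (hasDerivAt_compLinearMap_id_add_smul _ A v).congr_of_eventuallyEq <|
      (eventually_dualForm_compLinearMap b (φ t) A).mono fun s hs => DFunLike.congr_fun hs v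
  simp only [Function.comp_def, hR] at hflow horbit
  exact horbit.unique hequivariant ▸ hflow

theorem hasDerivWithinAt_dualForm_of_flow (b : Basis (Fin 7) ℝ V) {φ : ℝ → V [⋀^Fin 3]→ₗ[ℝ] ℝ}
    {J : Set ℝ} {t : ℝ} (hpos : IsPositive (φ t)) (A : V →ₗ[ℝ] V) (X : V)
    (hφ : ∀ m : Fin 3 → Fin 7, HasDerivWithinAt (fun s => φ s (b ∘ m))
      ((derivation (φ t) A + (dualForm b (φ t)).curryLeft X) (b ∘ m)) J t) (v : Fin 4 → V) :
    HasDerivWithinAt (fun s => dualForm b (φ s) v)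
      ((derivation (dualForm b (φ t)) A - AlternatingMap.alternatizeUncurryFin
        (((metricForm b (φ t)).flip X).smulRight (φ t))) v) J t := by
  obtain ⟨C, hC, hC'⟩ := exists_derivation_eq_curryLeft b hpos X
  rw [sub_eq_add_neg, ← hC', ← map_add]
  refine hasDerivWithinAt_dualForm b (det_matrixB_ne_zero b hpos) (A + C) (fun m => ?_) v
  rw [map_add, hC]
  exact hφ m

end Flow

section Manifold

variable {M : Type*} [TopologicalSpace M] [ChartedSpace (EuclideanSpace ℝ (Fin 7)) M]

theorem mdifferentiable_of_mem_maximalAtlas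
    {e : OpenPartialHomeomorph M (EuclideanSpace ℝ (Fin 7))}
    (he : e ∈ IsManifold.maximalAtlas (𝓡 7) ∞ M) : e.MDifferentiable (𝓡 7) (𝓡 7) :=
  ⟨(contMDiffOn_of_mem_maximalAtlas he).mdifferentiableOn (by simp),
    (contMDiffOn_symm_of_mem_maximalAtlas he).mdifferentiableOn (by simp)⟩

theorem psi_eq_dualForm (φ : G2Structure M) (x : M) (b : Basis (Fin 7) ℝ (TangentSpace (𝓡 7) x)) :
    φ.psi x = dualForm b (φ.form x) :=
  dualForm_eq b (tangentBasis x) _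

variable {e : OpenPartialHomeomorph M (EuclideanSpace ℝ (Fin 7))}
  (he : e ∈ IsManifold.maximalAtlas (𝓡 7) ∞ M) {y : EuclideanSpace ℝ (Fin 7)} (hy : y ∈ e.target)

/-- The basis of the tangent space formed by the coordinate vector fields of a chart. -/
def coordBasis : Basis (Fin 7) ℝ (TangentSpace (𝓡 7) (e.symm y)) :=
  (EuclideanSpace.basisFun (Fin 7) ℝ).toBasis.map <|
    LinearEquiv.ofLinearMap (mfderiv (𝓡 7) (𝓡 7) e.symm y).toLinearMap
      (mfderiv (𝓡 7) (𝓡 7) e (e.symm y)).toLinearMap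
      (LinearMap.ext fun v => by
        have hinv := (mdifferentiable_of_mem_maximalAtlas he).symm_comp_deriv (e.map_target hy)
        rw [e.right_inv hy] at hinv
        exact DFunLike.congr_fun hinv v)
      (LinearMap.ext fun v => DFunLike.congr_fun
        ((mdifferentiable_of_mem_maximalAtlas he).comp_symm_deriv hy) v)

theorem coordBasis_apply (i : Fin 7) : coordBasis he hy i = coordFrame e y i := by
  rw [coordBasis, Basis.map_apply, OrthonormalBasis.coe_toBasis, EuclideanSpace.basisFun_apply]
  rfl

theorem coordBasis_repr (v : TangentSpace (𝓡 7) (e.symm y)) (l : Fin 7) :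
    (coordBasis he hy).repr v l = coordComponent e y v l := by
  rw [coordBasis, Basis.map_repr]
  rfl

theorem lowerComp_eq_metricForm (φ : G2Structure M) (v : TangentSpace (𝓡 7) (e.symm y))
    (k : Fin 7) : φ.lowerComp e y v k =
      metricForm (coordBasis he hy) (φ.form (e.symm y)) (coordFrame e y k) v := by
  conv_rhs => rw [← (coordBasis he hy).sum_repr v]
  simp only [map_sum, map_smul, smul_eq_mul, coordBasis_repr, coordBasis_apply, metricForm_apply,
    metric_eq (tangentBasis (e.symm y)) (coordBasis he hy)]
  exact Finset.sum_congr rfl fun l _ => mul_comm _ _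

theorem IsGeneralFlow.hasDerivWithinAt_form {J : Set ℝ} {φ : ℝ → G2Structure M}
    {h : ℝ → ∀ x : M, LinearMap.BilinForm ℝ (TangentSpace (𝓡 7) x)}
    {X : ℝ → ∀ x : M, TangentSpace (𝓡 7) x} (hflow : IsGeneralFlow J φ h X) {t : ℝ} (ht : t ∈ J)
    (m : Fin 3 → Fin 7) :
    HasDerivWithinAt (fun s => (φ s).form (e.symm y) (coordBasis he hy ∘ m))
      ((derivation ((φ t).form (e.symm y)) (Matrix.toLin (coordBasis he hy) (coordBasis he hy)
          (.of ((φ t).mixedComp e y (h t (e.symm y)))))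
        + (dualForm (coordBasis he hy) ((φ t).form (e.symm y))).curryLeft (X t (e.symm y)))
          (coordBasis he hy ∘ m)) J t := by
  have hvec : coordBasis he hy ∘ m =
      ![coordBasis he hy (m 0), coordBasis he hy (m 1), coordBasis he hy (m 2)] :=
    (FinVec.etaExpand_eq _).symm
  have hcurry : (dualForm (coordBasis he hy) ((φ t).form (e.symm y))).curryLeft (X t (e.symm y))
      (coordBasis he hy ∘ m) = ∑ l, coordComponent e y (X t (e.symm y)) l *
        (φ t).psiComp e y l (m 0) (m 1) (m 2) := by
    conv_lhs => rw [← (coordBasis he hy).sum_repr (X t (e.symm y)), hvec, ← evalAt_apply]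
    simp only [map_sum, map_smul, evalAt_apply, smul_eq_mul, AlternatingMap.curryLeft_apply_apply,
      coordBasis_repr, coordBasis_apply, G2Structure.psiComp,
      psi_eq_dualForm _ _ (coordBasis he hy)]
  rw [AlternatingMap.add_apply, hcurry, hvec, derivation_toLin_three]
  simp only [coordBasis_apply, Matrix.of_apply, ← Finset.sum_add_distrib]
  exact hflow t ht e he y hy (m 0) (m 1) (m 2)

end Manifold

end G2Flow

end

theorem mainTheorem4_general {M : Type*} [TopologicalSpace M]
    [ChartedSpace (EuclideanSpace ℝ (Fin 7)) M]
    (J : Set ℝ) (φ : ℝ → G2Flow.G2Structure M)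
    (h : ℝ → ∀ x : M, LinearMap.BilinForm ℝ (TangentSpace (𝓡 7) x))
    (X : ℝ → ∀ x : M, TangentSpace (𝓡 7) x)
    (hflow : G2Flow.IsGeneralFlow J φ h X) :
    ∀ t ∈ J, ∀ e ∈ IsManifold.maximalAtlas (𝓡 7) ∞ M, ∀ y ∈ e.target, ∀ i j k l : Fin 7,
      HasDerivWithinAt (fun s => (φ s).psiComp e y i j k l)
        ((∑ m, ((φ t).mixedComp e y (h t (e.symm y)) m i * (φ t).psiComp e y m j k l
            + (φ t).mixedComp e y (h t (e.symm y)) m j * (φ t).psiComp e y i m k l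
            + (φ t).mixedComp e y (h t (e.symm y)) m k * (φ t).psiComp e y i j m l
            + (φ t).mixedComp e y (h t (e.symm y)) m l * (φ t).psiComp e y i j k m))
          - (φ t).lowerComp e y (X t (e.symm y)) i * (φ t).phiComp e y j k l
          + (φ t).lowerComp e y (X t (e.symm y)) j * (φ t).phiComp e y i k l
          - (φ t).lowerComp e y (X t (e.symm y)) k * (φ t).phiComp e y i j l
          + (φ t).lowerComp e y (X t (e.symm y)) l * (φ t).phiComp e y i j k) J t := by
  intro t ht e he y hy i j k l
  have hderiv := G2Flow.hasDerivWithinAt_dualForm_of_flow (G2Flow.coordBasis he hy)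
    ((φ t).positive (e.symm y)) _ _ (hflow.hasDerivWithinAt_form he hy ht)
    ![G2Flow.coordFrame e y i, G2Flow.coordFrame e y j, G2Flow.coordFrame e y k,
      G2Flow.coordFrame e y l]
  simp only [← G2Flow.psi_eq_dualForm] at hderiv
  refine hderiv.congr_deriv ?_
  rw [AlternatingMap.sub_apply, G2Flow.alternatizeUncurryFin_four]
  simp only [← G2Flow.coordBasis_apply he hy, G2Flow.derivation_toLin_four]
  simp only [Matrix.of_apply, LinearMap.smulRight_apply, LinearMap.BilinForm.flip_apply,
    AlternatingMap.smul_apply, smul_eq_mul, G2Flow.coordBasis_apply,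
    ← G2Flow.lowerComp_eq_metricForm]
  simp only [G2Flow.G2Structure.psiComp, G2Flow.G2Structure.phiComp]
  ring

theorem mainTheorem4 {M : Type*} [TopologicalSpace M]
    [ChartedSpace (EuclideanSpace ℝ (Fin 7)) M] [IsManifold (𝓡 7) ∞ M]
    (J : Set ℝ) (φ : ℝ → G2Flow.G2Structure M)
    (h : ℝ → ∀ x : M, LinearMap.BilinForm ℝ (TangentSpace (𝓡 7) x))
    (X : ℝ → ∀ x : M, TangentSpace (𝓡 7) x)
    (hsymm : ∀ t ∈ J, ∀ x, (h t x).IsSymm)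
    (hflow : G2Flow.IsGeneralFlow J φ h X) :
    ∀ t ∈ J, ∀ e ∈ IsManifold.maximalAtlas (𝓡 7) ∞ M, ∀ y ∈ e.target, ∀ i j k l : Fin 7,
      HasDerivWithinAt (fun s => (φ s).psiComp e y i j k l)
        ((∑ m, ((φ t).mixedComp e y (h t (e.symm y)) m i * (φ t).psiComp e y m j k l
            + (φ t).mixedComp e y (h t (e.symm y)) m j * (φ t).psiComp e y i m k l
            + (φ t).mixedComp e y (h t (e.symm y)) m k * (φ t).psiComp e y i j m l
            + (φ t).mixedComp e y (h t (e.symm y)) m l * (φ t).psiComp e y i j k m))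
          - (φ t).lowerComp e y (X t (e.symm y)) i * (φ t).phiComp e y j k l
          + (φ t).lowerComp e y (X t (e.symm y)) j * (φ t).phiComp e y i k l
          - (φ t).lowerComp e y (X t (e.symm y)) k * (φ t).phiComp e y i j l
          + (φ t).lowerComp e y (X t (e.symm y)) l * (φ t).phiComp e y i j k) J t :=
  mainTheorem4_general J φ h X hflow
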